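/- Throughout, $\log=\log_2$, $H$ is Shannon entropy in bits, rings are associative with $1$, and for a stochastic matrix $\mathbf P$ and a probability vector $\pi$, $H(\mathbf P|\pi)=-\sum_i\pi_i\sum_j \mathbf P_{i,j}\log \mathbf P_{i,j}$. For a non-empty set $A$ of states, $\mathbf S_A=\mathbf P_{A,A}+\mathbf P_{A,A^c}(\mathbf 1-\mathbf P_{A^c,A^c})^{-1}\mathbf P_{A^c,A}$ denotes the stochastic complement of $\mathbf P_{A,A}$ in $\mathbf P$. Let $g:\{0,1\}^3\to\mathbb Z_4$, $g(x_1,x_2,x_3)=x_1+2x_2+3x_3$. Let $u$ be the distribution on $\{0,1\}^3$ with $u_{(0,0,1)}=u_{(1,1,0)}=7/15$ and $u_x=1/90$ for the other six $x$, and let $\mathbf P_0=0.87\,\mathbf U+0.13\cdot\mathbf 1$, where all rows of $\mathbf U$ equal $u$ (to four decimals, the diagonal entries of $\mathbf P_0$ are $.5360$ at $(0,0,1),(1,1,0)$ and $.1397$ elsewhere, and its off-diagonal entries are $.4060$ in the columns $(0,0,1),(1,1,0)$ and $.0097$ in the other columns). Let $X^{(n)}=(X_1^{(n)},X_2^{(n)},X_3^{(n)})$,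 $n\ge1$, be a homogeneous Markov chain on $\{0,1\}^3$ with transition matrix $\mathbf P_0$ and any initial distribution; such chains exist. *Regions.* Let $\mathcal R[g]\subset\mathbb R^3$ be the set of rate vectors $(R_1,R_2,R_3)$ such that for every $\epsilon>0$ and all sufficiently large $n$ there are encoders $\phi_t:\{0,1\}^n\to[1,2^{nR_t}]$ and a decoder $\psi$ with values in $\mathbb Z_4^n$ that recovers $(g(X^{(1)}),\dots,g(X^{(n)}))$ from $\phi_1(X_1^n),\phi_2(X_2^n),\phi_3(X_3^n)$, where $X_t^n=(X_t^{(1)},\dots,X_t^{(n)})$, with error probability less than $\epsilon$. Let $$\mathcal R_3=\Big\{(R_1,R_2,R_3)\in\mathbb R^3\ \Big|\ \sum_{t\in T}R_t>\lim_{n\to\infty}\tfrac1n\big[H(X^{(n)},\dots,X^{(1)})-H(X_{T^c}^{(n)},\dots,X_{T^c}^{(1)})\big]\ \ \forall\,\emptyset\ne T\subseteq\{1,2,3\}\Big\}.$$ A presentation of $g$ over a non-zero finite ring $\mathfrak R$ consists of functions $k_t:\{0,1\}\to\mathfrak R$ ($t=1,2,3$) and $h:\mathfrak R\to\mathbb Z_4$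 with $g(x_1,x_2,x_3)=h(k_1(x_1)+k_2(x_2)+k_3(x_3))$. For a presentation, $Z^{(n)}=\sum_t k_t(X_t^{(n)})$ is an irreducible Markov chain on the set $\{\sum_t k_t(x_t)\}\subseteq\mathfrak R$; let $\mathbf P$ and $\pi$ be its transition matrix and invariant distribution, and let $$\mathcal R_{\mathfrak R}=\Big\{(R,R,R)\ \Big|\ R>\max_{0\ne\mathfrak I\le_l\mathfrak R}\frac{\log|\mathfrak R|}{\log|\mathfrak I|}\min\Big\{H(\mathbf S_{\mathfrak R/\mathfrak I}|\pi),\ H(\mathbf P|\pi)-\lim_{m\to\infty}H\big(Y^{(m)}\,\big|\,Y^{(m-1)}\big)\Big\}\Big\},$$ where the maximum is over the non-zero left ideals $\mathfrak I$ of $\mathfrak R$, $Y^{(m)}=Z^{(m)}+\mathfrak I$, and $\mathbf S_{\mathfrak R/\mathfrak I}=\mathrm{diag}\{\mathbf S_A\}$ with $A$ running over the cosets of $\mathfrak I$ (intersected with the state space of $Z$, empty intersections omitted). Let $\mathcal R_{\mathbb Z_4}$ be the region of the presentation $k_1(x)=x$, $k_2(x)=2x$, $k_3(x)=3x$, $h=\mathrm{id}$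 over $\mathbb Z_4$. **Theorem.** In this situation linear coding over finite fields is not optimal: 1. for every finite field $\mathbb F$ and every presentation of $g$ over $\mathbb F$, $\mathcal R_{\mathbb F}\subsetneq\mathcal R_{\mathbb Z_4}$; 2. with unions over all finite fields $\mathbb F$, respectively all non-zero finite rings $\mathfrak R$, and all presentations of $g$ over them, $$\mathcal R_3\cup\bigcup_{\mathbb F}\bigcup_{(k,h)}\mathcal R_{\mathbb F}\ \subsetneq\ \mathcal R_3\cup\bigcup_{\mathfrak R}\bigcup_{(k,h)}\mathcal R_{\mathfrak R},$$ and already $\mathcal R_{\mathbb Z_4}$ is not contained in the left-hand side; 3. the rates in $\mathcal R_{\mathbb Z_4}$ are achieved by linear coding over $\mathbb Z_4$: for every $(R_1,R_2,R_3)\in\mathcal R_{\mathbb Z_4}$, every $\epsilon>0$ and all sufficiently large $n$ there are $\mathbb Z_4$-linear maps $\phi_t:\mathbb Z_4^n\to\mathbb Z_4^{m_t}$ with $4^{m_t}\le2^{nR_t}$ and a decoder that recovers $(g(X^{(1)}),\dots,g(X^{(n)}))$ from $\phi_t(k_t(X_t^{(1)}),\dots,k_t(X_t^{(n)}))$, $t=1,2,3$,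 with error probability less than $\epsilon$. In particular $\mathcal R_{\mathbb Z_4}\subseteq\mathcal R[g]$. -/

import Mathlib

open MeasureTheory Filter Topology

noncomputable section

namespace MarkovCoding

/-! ### Entropy -/

section Entropy

variable {Ω : Type*} [MeasurableSpace Ω]

/-- Shannon entropy in bits, `H(W) = - ∑ₐ P(W = a) log₂ P(W = a)`, of a random variable `W` with
a finite sample space. -/
def entropy {α : Type*} [Finite α] (μ : Measure Ω) (W : Ω → α) : ℝ :=
  ∑ᶠ a, Real.negMulLog (μ.real (W ⁻¹' {a})) / Real.log 2

/-- Conditional entropy in bits, `H(V | W) = H(V, W) - H(W)`. -/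
def condEntropy {α β : Type*} [Finite α] [Finite β] (μ : Measure Ω) (V : Ω → α) (W : Ω → β) : ℝ :=
  entropy μ (fun ω => (V ω, W ω)) - entropy μ W

end Entropy

/-- `H(P | π)` in bits: the conditional entropy of the second coordinate given the first one, when
the pair has the joint distribution `(i, j) ↦ π i * P i j`. -/
def matrixEntropy {σ : Type*} [Fintype σ] (P : Matrix σ σ ℝ) (π : σ → ℝ) : ℝ :=
  ∑ i, π i * ∑ j, Real.negMulLog (P i j) / Real.log 2

/-! ### Markov chains -/

/-- `X 0, X 1, …` is a homogeneous Markov chain with finite state space `σ` and transition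
matrix `P`; the initial distribution is arbitrary. The last field is
`Pr(X (n+1) = j | X n = i, X (n-1) = …, …, X 0 = …) = P i j`, multiplied out. -/
structure IsMarkovChain {Ω σ : Type*} [MeasurableSpace Ω] [Fintype σ]
    (μ : Measure Ω) (X : ℕ → Ω → σ) (P : Matrix σ σ ℝ) : Prop where
  measurable : ∀ n a, MeasurableSet (X n ⁻¹' {a})
  nonneg : ∀ i j, 0 ≤ P i j
  row_sum : ∀ i, ∑ j, P i j = 1
  transition : ∀ (n : ℕ) (a : ℕ → σ),
    μ.real {ω | ∀ i ≤ n + 1, X i ω = a i} =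
      μ.real {ω | ∀ i ≤ n, X i ω = a i} * P (a n) (a (n + 1))

/-- Irreducibility: there is no set `∅ ≠ A ⊊ σ` of states with `P_{A, Aᶜ} = 0`. -/
def IrreducibleMatrix {σ : Type*} (P : Matrix σ σ ℝ) : Prop :=
  ¬ ∃ A : Set σ, A.Nonempty ∧ A ≠ Set.univ ∧ ∀ i ∈ A, ∀ j ∉ A, P i j = 0

/-- `π` is an invariant (stationary) distribution of `P`. -/
def IsInvariantDistribution {σ : Type*} [Fintype σ] (P : Matrix σ σ ℝ) (π : σ → ℝ) : Prop :=
  (∀ i, 0 ≤ π i) ∧ ∑ i, π i = 1 ∧ ∀ j, ∑ i, π i * P i j = π j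

open Classical in
/-- The stochastic complement
`S_A = P_{A,A} + P_{A,Aᶜ} (1 - P_{Aᶜ,Aᶜ})⁻¹ P_{Aᶜ,A}` of `P_{A,A}` in `P`, for `A = {x | p x}`. -/
def stochComplement {σ : Type*} [Fintype σ] (P : Matrix σ σ ℝ) (p : σ → Prop) :
    Matrix {x // p x} {x // p x} ℝ :=
  P.toBlock p p +
    P.toBlock p (fun x => ¬ p x) *
      (1 - P.toBlock (fun x => ¬ p x) (fun x => ¬ p x))⁻¹ *
        P.toBlock (fun x => ¬ p x) p

open Classical in
/-- The block diagonal matrix `diag {S_A}_A` of the stochastic complements, where `A` runs over the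
classes of the partition of `σ` into the fibres of `c`. -/
def blockStochComplement {σ κ : Type*} [Fintype σ] (P : Matrix σ σ ℝ) (c : σ → κ) :
    Matrix σ σ ℝ :=
  Matrix.of fun i j =>
    if h : c j = c i then stochComplement P (fun x => c x = c i) ⟨i, rfl⟩ ⟨j, h⟩ else 0

/-! ### Encoding a function of several sources

`ι` is the set of sources, `𝒳 t` the alphabet of the source `t`, and `X n ω t` is the
symbol that the source `t` produces at time `n + 1`. -/

section Regions

variable {Ω : Type*} [MeasurableSpace Ω] {ι : Type*} [Fintype ι] {𝒳 : ι → Type*}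
  [∀ t, Fintype (𝒳 t)] {𝒴 : Type*}

/-- The achievable coding rate region `𝓡[g]`: rate vectors `R` such that for each `ε > 0` and all
large `n` there are encoders `φ t : 𝒳 t ^ n → [1, 2 ^ (n R t)]` and a decoder that
recovers `g (X 0), …, g (X (n - 1))` with error probability less than `ε`. -/
def achievableRegion (μ : Measure Ω) (X : ℕ → Ω → ∀ t, 𝒳 t) (g : (∀ t, 𝒳 t) → 𝒴) :
    Set (ι → ℝ) :=
  {R | ∀ ε > (0 : ℝ), ∃ N₀ : ℕ, ∀ n > N₀,
    ∃ (φ : ∀ t, (Fin n → 𝒳 t) → Fin ⌊(2 : ℝ) ^ ((n : ℝ) * R t)⌋₊)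
      (ψ : (∀ t, Fin ⌊(2 : ℝ) ^ ((n : ℝ) * R t)⌋₊) → Fin n → 𝒴),
      μ.real {ω | (fun i : Fin n => g (X i ω)) ≠
        ψ (fun t => φ t (fun i : Fin n => X i ω t))} < ε}

/-- Rate vectors that are achievable with linear coding over `ℛ`: the symbols of the
source `t` are mapped to `ℛ` by `k t`, and the encoder of the source `t` is then a (left)
linear mapping `ℛ ^ n → ℛ ^ (m t)` with `|ℛ| ^ (m t) ≤ 2 ^ (n R t)`. -/
def linearlyAchievableRegion (μ : Measure Ω) (X : ℕ → Ω → ∀ t, 𝒳 t) (g : (∀ t, 𝒳 t) → 𝒴)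
    {ℛ : Type*} [Ring ℛ] [Fintype ℛ] (k : ∀ t, 𝒳 t → ℛ) : Set (ι → ℝ) :=
  {R | ∀ ε > (0 : ℝ), ∃ N₀ : ℕ, ∀ n > N₀,
    ∃ m : ι → ℕ, (∀ t, (Fintype.card ℛ : ℝ) ^ m t ≤ (2 : ℝ) ^ ((n : ℝ) * R t)) ∧
    ∃ (A : ∀ t, Matrix (Fin (m t)) (Fin n) ℛ) (ψ : (∀ t, Fin (m t) → ℛ) → Fin n → 𝒴),
      μ.real {ω | (fun i : Fin n => g (X i ω)) ≠
        ψ (fun t => (A t).mulVec (fun i : Fin n => k t (X i ω t)))} < ε}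

/-- The region `𝓡_s` obtained by first decoding all the sources: for each nonempty `T`,
`∑_{t ∈ T} R t` exceeds
`lim (1/n) [H(X^(n), …, X^(1)) - H(X_{Tᶜ}^(n), …, X_{Tᶜ}^(1))]`. -/
def sourceRegion (μ : Measure Ω) (X : ℕ → Ω → ∀ t, 𝒳 t) : Set (ι → ℝ) :=
  {R | ∀ T : Finset ι, T.Nonempty → ∃ ℓ : ℝ,
    Tendsto (fun n : ℕ => (1 / (n : ℝ)) *
      (entropy μ (fun ω (i : Fin n) => X i ω) -
        entropy μ (fun ω (i : Fin n) (t : {t // t ∉ T}) => X i ω t))) atTop (𝓝 ℓ) ∧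
    ℓ < ∑ t ∈ T, R t}

/-- `(k, h)` is a presentation `g (x) = h (∑ t, k t (x t))` of `g` over `ℛ`. -/
def IsPresentation (g : (∀ t, 𝒳 t) → 𝒴) {ℛ : Type*} [Ring ℛ] (k : ∀ t, 𝒳 t → ℛ) (h : ℛ → 𝒴) :
    Prop :=
  ∀ x, g x = h (∑ t, k t (x t))

/-- The set of values of `∑ t, k t (x t)`, the state space of the process `sumProcess`. -/
abbrev SumState {ℛ : Type*} [Ring ℛ] (k : ∀ t, 𝒳 t → ℛ) : Type _ :=
  Set.range fun x : ∀ t, 𝒳 t => ∑ t, k t (x t)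

/-- The process `Z^(n) = ∑ t, k t (X_t^(n))`. -/
def sumProcess {ℛ : Type*} [Ring ℛ] (k : ∀ t, 𝒳 t → ℛ) (X : ℕ → Ω → ∀ t, 𝒳 t) :
    ℕ → Ω → SumState k :=
  fun n ω => ⟨∑ t, k t (X n ω t), X n ω, rfl⟩

/-- The coset of a state modulo a left ideal `I` (for a ring that need not be commutative,
`Ideal ℛ` is the type of left ideals of `ℛ`). -/
def sumCoset {ℛ : Type*} [Ring ℛ] (k : ∀ t, 𝒳 t → ℛ) (I : Ideal ℛ) (z : SumState k) :
    ℛ ⧸ Submodule.toAddSubgroup I :=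
  QuotientAddGroup.mk (z : ℛ)

open Classical in
/-- The region `𝓡_ℛ` attached to `k`, for Markov sources for which the process `Z = ∑ t, k t (X t)`
and its reductions modulo left ideals are Markov chains: the vectors `[R, …, R]` such that
`R > max_{0 ≠ I ≤ₗ ℛ} (log |ℛ| / log |I|) *
  min {H(S_{ℛ/I} | π), H(P | π) - lim H(Y^(m) | Y^(m-1))}`,
where `P` and `π` are the transition matrix and the invariant distribution of the irreducible
Markov chain `Z`, and `Y^(m) = Z^(m) + I`. -/
def ringRegion (μ : Measure Ω) (X : ℕ → Ω → ∀ t, 𝒳 t)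
    {ℛ : Type*} [Ring ℛ] [Fintype ℛ] (k : ∀ t, 𝒳 t → ℛ) : Set (ι → ℝ) :=
  {R | ∃ r : ℝ, (R = fun _ => r) ∧
    ∃ (P : Matrix (SumState k) (SumState k) ℝ) (π : SumState k → ℝ),
      IsMarkovChain μ (sumProcess k X) P ∧ IrreducibleMatrix P ∧ IsInvariantDistribution P π ∧
      ∀ I : Ideal ℛ, I ≠ ⊥ → ∃ ℓ : ℝ,
        Tendsto (fun m : ℕ => condEntropy μ
          (fun ω => sumCoset k I (sumProcess k X (m + 1) ω))
          (fun ω => sumCoset k I (sumProcess k X m ω))) atTop (𝓝 ℓ) ∧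
        Real.log (Fintype.card ℛ) / Real.log (Nat.card I) *
          min (matrixEntropy (blockStochComplement P (sumCoset k I)) π)
            (matrixEntropy P π - ℓ) < r}

/-- `𝓡_s ∪ ⋃_ℛ ⋃_{(k, h)} 𝓡_ℛ`, over all nonzero finite rings `ℛ` and all
presentations of `g` over `ℛ`. -/
def ringCodingRegion (μ : Measure Ω) (X : ℕ → Ω → ∀ t, 𝒳 t) (g : (∀ t, 𝒳 t) → 𝒴) :
    Set (ι → ℝ) :=
  sourceRegion μ X ∪
    {R | ∃ (ℛ : Type) (_ : Ring ℛ) (_ : Nontrivial ℛ) (_ : Fintype ℛ)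
      (k : ∀ t, 𝒳 t → ℛ) (h : ℛ → 𝒴), IsPresentation g k h ∧ R ∈ ringRegion μ X k}

/-- `𝓡_s ∪ ⋃_𝔽 ⋃_{(k, h)} 𝓡_𝔽`: the same union, over finite fields only. -/
def fieldCodingRegion (μ : Measure Ω) (X : ℕ → Ω → ∀ t, 𝒳 t) (g : (∀ t, 𝒳 t) → 𝒴) :
    Set (ι → ℝ) :=
  sourceRegion μ X ∪
    {R | ∃ (𝔽 : Type) (_ : Field 𝔽) (_ : Fintype 𝔽)
      (k : ∀ t, 𝒳 t → 𝔽) (h : 𝔽 → 𝒴), IsPresentation g k h ∧ R ∈ ringRegion μ X k}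

end Regions

/-! ### The three binary Markov sources and the function `x₁ + 2 x₂ + 3 x₃` over `ℤ₄` -/

/-- `g (x₁, x₂, x₃) = x₁ + 2 x₂ + 3 x₃ ∈ ℤ₄` on `{0, 1}³`. -/
def exampleFun (x : Fin 3 → Fin 2) : ZMod 4 :=
  ((x 0 : ℕ) : ZMod 4) + 2 * ((x 1 : ℕ) : ZMod 4) + 3 * ((x 2 : ℕ) : ZMod 4)

/-- The presentation of `exampleFun` over `ℤ₄` (with `h` the identity): `k₁ (x) = x`,
`k₂ (x) = 2 x`, `k₃ (x) = 3 x`. -/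
def exampleCoeff (t : Fin 3) (x : Fin 2) : ZMod 4 :=
  (((t : ℕ) + 1 : ℕ) : ZMod 4) * ((x : ℕ) : ZMod 4)

/-- The distribution `u` on `{0, 1}³`. -/
def exampleDist (x : Fin 3 → Fin 2) : ℝ :=
  if x = ![0, 0, 1] ∨ x = ![1, 1, 0] then 7 / 15 else 1 / 90

/-- The transition matrix `c₁ U + (1 - c₁) 1` with `c₁ = 0.87`, all rows of `U` being equal to
`u`. Rounded to four decimals its entries are `.1397`, `.5360` (diagonal) and `.0097`, `.4060`. -/
def exampleMatrix : Matrix (Fin 3 → Fin 2) (Fin 3 → Fin 2) ℝ :=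
  Matrix.of fun x y => 87 / 100 * exampleDist y + 13 / 100 * (if x = y then 1 else 0)

end MarkovCoding

end

open MarkovCoding

/-!
The matrix of the sources describes a *refresh chain*: with probability `c` the next state is a
fresh sample of a distribution `v`, otherwise the state stays the same. Everything in the statement
preserves this class. A lumping of a refresh chain is a refresh chain for the pushed forward
distribution (`IsMarkovChain.lump_refreshMatrix`), so the processes `∑ t, k t (X t)` and their
reductions modulo ideals are refresh chains, and a stochastic complement of a refresh chain is one
for the conditional distribution (`stochComplement_refreshMatrix`). The entropy rate is a sum over
the states, `∑ φ (v i)` with `φ = refreshEntropy c`. Subadditivity of `φ` says that lumping does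
not increase the rate (`refreshRate_pushDist_mono`). The inequality `φ (p s) ≤ s φ p + p φ s`, an
instance of the concavity of entropy, says that the second expression of the minimum in `ringRegion`
never exceeds the first one (`refreshRate_sub_le_matrixEntropy`). Hence membership in `ringRegion`
is a list of inequalities between entropy rates of lumped chains (`mem_ringRegion_iff`).

All comparisons are made at the rate vector `(9/20, 9/20, 9/20)`. It lies in the region of `ZMod 4`,
whose thresholds are `0.442…` for the ideal `ZMod 4` and `0.375…` for `2 ZMod 4`. It is outside
`sourceRegion`, because the entropy rate of the sources is `1.423… > 3 * 9/20`. It is outside the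
region of every field (`lt_lumpedRate_of_field`): a presentation over a field that identifies
the two likely states cannot also identify `(1, 0, 0)` with `(0, 1, 1)`, so its sum process has at
least the entropy rate `0.462…` of a five-state chain; a presentation that does not identify them
has rate at least `0.984…`. The numerical bounds reduce to comparisons of integer powers.

For achievability, the same uniformly random matrix with `m ≈ n r / 2` rows is applied at all
terminals, so that the decoder sees the image of `z = ∑ t, k t (X t)`. A difference of two sequences
with an odd coordinate is annihilated with probability `4 ^ (-m)`, any other non-zero difference
with probability at most `2 ^ (-m)`. There are about `2 ^ (n H)` typical sequences, of which about
`2 ^ (n (H - H'))` agree with a given one modulo `2`, where `H` and `H'` are the entropy rates of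
the sum process and of its parity (`IsMarkovChain.exists_typicalSet`); this is where the two
thresholds `H` and `2 (H - H')` come from. Typicality rests on a weak law of large numbers, proved
by bounding a second moment with the help of the explicit solution of the Poisson equation.
-/

noncomputable section

namespace MarkovCoding

open MeasureTheory Filter Topology
open Real (negMulLog)

/-! ### The entropy rate of a refresh chain -/

section RefreshEntropy

variable {σ τ κ : Type*}

theorem negMulLog_add_le {a b : ℝ} (ha : 0 ≤ a) (hb : 0 ≤ b) :
    negMulLog (a + b) ≤ negMulLog a + negMulLog b := by
  rcases ha.eq_or_lt with rfl | ha
  · simp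
  rcases hb.eq_or_lt with rfl | hb
  · simp
  have h1 : Real.log a ≤ Real.log (a + b) := Real.log_le_log ha (by linarith)
  have h2 : Real.log b ≤ Real.log (a + b) := Real.log_le_log hb (by linarith)
  simp only [negMulLog]
  nlinarith

/-- The transition matrix of the chain that, at each step, moves with probability `c` to a fresh
sample of the distribution `v`, and stays where it is otherwise. -/
def refreshMatrix [DecidableEq σ] (c : ℝ) (v : σ → ℝ) : Matrix σ σ ℝ :=
  Matrix.of fun i j => c * v j + (1 - c) * (if i = j then 1 else 0)

theorem refreshMatrix_apply [DecidableEq σ] (c : ℝ) (v : σ → ℝ) (i j : σ) :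
    refreshMatrix c v i j = c * v j + (1 - c) * (if i = j then 1 else 0) := rfl

/-- The contribution (in nats) of a state of stationary probability `x` to the entropy rate of
a refresh chain: the chain enters the state from itself with probability `c x + (1 - c)`, and from
any other state with probability `c x`. -/
def refreshEntropy (c x : ℝ) : ℝ :=
  x * negMulLog (c * x + (1 - c)) + (1 - x) * negMulLog (c * x)

/-- The entropy rate, in bits, of the stationary refresh chain with fresh distribution `v`. -/
def refreshRate [Fintype σ] (c : ℝ) (v : σ → ℝ) : ℝ :=
  (∑ i, refreshEntropy c (v i)) / Real.log 2

@[simp] theorem refreshEntropy_zero (c : ℝ) : refreshEntropy c 0 = 0 := by simp [refreshEntropy]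

@[simp] theorem refreshEntropy_one (c : ℝ) : refreshEntropy c 1 = 0 := by simp [refreshEntropy]

theorem refreshEntropy_nonneg {c x : ℝ} (hc : 0 ≤ c) (hc1 : c ≤ 1) (hx : 0 ≤ x) (hx1 : x ≤ 1) :
    0 ≤ refreshEntropy c x := by
  have h : c * x ≤ 1 := mul_le_one₀ hc1 hx hx1
  have h' : c * x + (1 - c) ≤ 1 := by nlinarith
  have := Real.negMulLog_nonneg (by positivity : 0 ≤ c * x) h
  have := Real.negMulLog_nonneg (by nlinarith : 0 ≤ c * x + (1 - c)) h'
  have : 0 ≤ 1 - x := by linarith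
  unfold refreshEntropy
  positivity

theorem refreshEntropy_add_le {c a b : ℝ} (hc : 0 ≤ c) (hc1 : c ≤ 1) (ha : 0 ≤ a) (hb : 0 ≤ b)
    (hab : a + b ≤ 1) :
    refreshEntropy c (a + b) ≤ refreshEntropy c a + refreshEntropy c b := by
  have hca : 0 ≤ c * a := by positivity
  have hcb : 0 ≤ c * b := by positivity
  have h1 := negMulLog_add_le (a := c * a + (1 - c)) (b := c * b) (by linarith) hcb
  have h2 := negMulLog_add_le (a := c * a) (b := c * b + (1 - c)) hca (by linarith)
  have h3 := negMulLog_add_le hca hcb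
  have e1 : c * a + (1 - c) + c * b = c * (a + b) + (1 - c) := by ring
  have e2 : c * a + (c * b + (1 - c)) = c * (a + b) + (1 - c) := by ring
  have e3 : c * a + c * b = c * (a + b) := by ring
  rw [e1] at h1
  rw [e2] at h2
  rw [e3] at h3
  have := mul_le_mul_of_nonneg_left h1 ha
  have := mul_le_mul_of_nonneg_left h2 hb
  have := mul_le_mul_of_nonneg_left h3 (sub_nonneg.2 hab)
  unfold refreshEntropy
  linarith

theorem refreshEntropy_sum_le {c : ℝ} (hc : 0 ≤ c) (hc1 : c ≤ 1) (s : Finset σ) (v : σ → ℝ)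
    (hv : ∀ i, 0 ≤ v i) (hs : ∑ i ∈ s, v i ≤ 1) :
    refreshEntropy c (∑ i ∈ s, v i) ≤ ∑ i ∈ s, refreshEntropy c (v i) := by
  classical
  induction s using Finset.induction_on with
  | empty => simp
  | insert a s ha ih =>
    rw [Finset.sum_insert ha] at hs ⊢
    rw [Finset.sum_insert ha]
    have h0 : 0 ≤ ∑ i ∈ s, v i := Finset.sum_nonneg fun i _ => hv i
    have := refreshEntropy_add_le hc hc1 (hv a) h0 hs
    have := ih (by linarith [hv a])
    linarith

/-- The contribution of a state that has probability `p` relative to a class of probability `s`.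
Summed over all states, the left-hand side is the entropy rate of the chain, and the right-hand side
is that of the chains watched inside the classes plus that of the lumped chain. The inequality is
concavity of entropy for the mixtures `c p + (1 - c) = l * ((c p s + (1 - c)) / l) + (1 - l) * p`
and `c p = l * (c p s / l) + (1 - l) * p`, where `l = c s + (1 - c)`. -/
theorem refreshEntropy_mul_le {c p s : ℝ} (hc : 0 < c) (hc1 : c ≤ 1) (hp : 0 ≤ p) (hp1 : p ≤ 1)
    (hs : 0 < s) (hs1 : s ≤ 1) :
    refreshEntropy c (p * s) ≤ s * refreshEntropy c p + p * refreshEntropy c s := by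
  set l : ℝ := c * s + (1 - c) with hl
  have hl0 : 0 < l := by have := mul_pos hc hs; linarith
  have hl1 : 0 ≤ 1 - l := by rw [hl]; nlinarith
  have key : ∀ x : ℝ, 0 ≤ x →
      negMulLog x - x / l * negMulLog l + (1 - l) * negMulLog p
        ≤ negMulLog (x + (1 - l) * p) := by
    intro x hx
    have h := Real.concaveOn_negMulLog.2 (x := x / l) (y := p) (by simp; positivity) (by simpa)
      hl0.le hl1 (by ring)
    have e : negMulLog x = x / l * negMulLog l + l * negMulLog (x / l) := by
      rw [← Real.negMulLog_mul, mul_div_cancel₀ _ hl0.ne']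
    simp only [smul_eq_mul, mul_div_cancel₀ x hl0.ne'] at h
    linarith
  have hps : 0 ≤ c * (p * s) := by positivity
  have k1 := key (c * (p * s) + (1 - c)) (by linarith)
  have k2 := key (c * (p * s)) hps
  have e1 : c * (p * s) + (1 - c) + (1 - l) * p = c * p + (1 - c) := by rw [hl]; ring
  have e2 : c * (p * s) + (1 - l) * p = c * p := by rw [hl]; ring
  rw [e1] at k1
  rw [e2] at k2
  have k3 := add_le_add (mul_le_mul_of_nonneg_left k1 hp)
    (mul_le_mul_of_nonneg_left k2 (sub_nonneg.2 hp1))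
  have e3 : p * ((c * (p * s) + (1 - c)) / l) + (1 - p) * (c * (p * s) / l) = p := by
    field_simp
    rw [hl]; ring
  have k4 : p * negMulLog (c * (p * s) + (1 - c)) + (1 - p) * negMulLog (c * (p * s))
      - p * negMulLog l + (1 - l) * negMulLog p ≤ refreshEntropy c p := by
    unfold refreshEntropy
    refine le_trans (le_of_eq ?_) k3
    linear_combination negMulLog l * e3
  have e4 : negMulLog (c * (p * s)) = p * negMulLog (c * s) + c * s * negMulLog p := by
    rw [← Real.negMulLog_mul]; congr 1; ring
  have k5 := mul_le_mul_of_nonneg_left k4 hs.le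
  have e5 : refreshEntropy c s = s * negMulLog l + (1 - s) * negMulLog (c * s) := rfl
  rw [e5]
  refine le_trans (le_of_eq ?_) (add_le_add_left k5 _)
  unfold refreshEntropy
  rw [e4, hl]
  ring

/-- The distribution of `e x` when `x` has distribution `v`. -/
def pushDist [Fintype σ] [DecidableEq τ] (v : σ → ℝ) (e : σ → τ) (y : τ) : ℝ :=
  ∑ x with e x = y, v x

section Push

variable [Fintype σ] [DecidableEq τ] [DecidableEq κ]

theorem pushDist_nonneg {v : σ → ℝ} (hv : ∀ x, 0 ≤ v x) (e : σ → τ) (y : τ) :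
    0 ≤ pushDist v e y := Finset.sum_nonneg fun x _ => hv x

theorem pushDist_pos {v : σ → ℝ} (hv : ∀ x, 0 < v x) (e : σ → τ) (x : σ) :
    0 < pushDist v e (e x) :=
  Finset.sum_pos (fun x _ => hv x) ⟨x, by simp⟩

variable [Fintype τ]

theorem sum_pushDist (v : σ → ℝ) (e : σ → τ) : ∑ y, pushDist v e y = ∑ x, v x :=
  Finset.sum_fiberwise _ _ _

theorem pushDist_comp (v : σ → ℝ) (e : σ → τ) (f : τ → κ) :
    pushDist v (f ∘ e) = pushDist (pushDist v e) f := by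
  funext y
  simp only [pushDist, Finset.sum_filter]
  have : ∀ z, (if f z = y then ∑ x, (if e x = z then v x else 0) else 0)
      = ∑ x, if e x = z then (if f (e x) = y then v x else 0) else 0 := by
    intro z
    split_ifs with h
    · refine Finset.sum_congr rfl fun x _ => ?_
      by_cases hx : e x = z
      · simp [hx, h]
      · simp [hx]
    · symm
      refine Finset.sum_eq_zero fun x _ => ?_
      by_cases hx : e x = z
      · simp [hx, h]
      · simp [hx]
  simp_rw [this]
  rw [Finset.sum_comm]
  simp

theorem pushDist_le_one {v : σ → ℝ} (hv : ∀ x, 0 ≤ v x) (h1 : ∑ x, v x = 1) (e : σ → τ) (y : τ) :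
    pushDist v e y ≤ 1 := by
  rw [← h1, ← sum_pushDist v e]
  exact Finset.single_le_sum (fun z _ => pushDist_nonneg hv e z) (Finset.mem_univ y)

variable [Fintype κ]

/-- Lumping states does not increase the entropy rate. -/
theorem refreshRate_pushDist_le {c : ℝ} (hc : 0 ≤ c) (hc1 : c ≤ 1) {v : σ → ℝ}
    (hv : ∀ x, 0 ≤ v x) (h1 : ∑ x, v x = 1) (f : σ → τ) :
    refreshRate c (pushDist v f) ≤ refreshRate c v := by
  unfold refreshRate
  refine div_le_div_of_nonneg_right ?_ (Real.log_nonneg (by norm_num))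
  rw [← Finset.sum_fiberwise Finset.univ f]
  refine Finset.sum_le_sum fun y _ => ?_
  exact refreshEntropy_sum_le hc hc1 _ v hv (pushDist_le_one hv h1 f y)

theorem refreshRate_pushDist_comp_le {c : ℝ} (hc : 0 ≤ c) (hc1 : c ≤ 1) {v : σ → ℝ}
    (hv : ∀ x, 0 ≤ v x) (h1 : ∑ x, v x = 1) (e : σ → τ) (f : τ → κ) :
    refreshRate c (pushDist v (f ∘ e)) ≤ refreshRate c (pushDist v e) := by
  rw [pushDist_comp]
  exact refreshRate_pushDist_le hc hc1 (pushDist_nonneg hv e) (by rw [sum_pushDist, h1]) f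

theorem refreshRate_pushDist_mono {c : ℝ} (hc : 0 ≤ c) (hc1 : c ≤ 1) {v : σ → ℝ}
    (hv : ∀ x, 0 ≤ v x) (h1 : ∑ x, v x = 1) (e : σ → τ) (f : σ → κ)
    (h : ∀ x y, e x = e y → f x = f y) :
    refreshRate c (pushDist v f) ≤ refreshRate c (pushDist v e) := by
  have hne : Nonempty σ := by
    by_contra hσ
    rw [not_nonempty_iff] at hσ
    simp at h1
  obtain ⟨x₀⟩ := hne
  have hf : Function.FactorsThrough f e := fun x y hxy => h x y hxy
  have hfe : Function.extend e f (fun _ => f x₀) ∘ e = f := by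
    funext x
    exact hf.extend_apply _ x
  rw [← hfe]
  exact refreshRate_pushDist_comp_le hc hc1 hv h1 _ _

end Push

section Matrix

variable [DecidableEq σ]

theorem sum_refreshMatrix [Fintype σ] {c : ℝ} {v : σ → ℝ} (h1 : ∑ x, v x = 1) (i : σ) :
    ∑ j, refreshMatrix c v i j = 1 := by
  simp [refreshMatrix_apply, Finset.sum_add_distrib, ← Finset.mul_sum, h1]

theorem refreshMatrix_nonneg {c : ℝ} (hc : 0 ≤ c) (hc1 : c ≤ 1) {v : σ → ℝ}
    (hv : ∀ x, 0 ≤ v x) (i j : σ) : 0 ≤ refreshMatrix c v i j := by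
  rw [refreshMatrix_apply]
  have := mul_nonneg hc (hv j)
  split_ifs <;> linarith

theorem refreshMatrix_pos {c : ℝ} (hc : 0 < c) (hc1 : c ≤ 1) {v : σ → ℝ}
    (hv : ∀ x, 0 < v x) (i j : σ) : 0 < refreshMatrix c v i j := by
  rw [refreshMatrix_apply]
  have := mul_pos hc (hv j)
  split_ifs <;> linarith

theorem sum_mul_refreshMatrix [Fintype σ] {c : ℝ} {v : σ → ℝ} (w : σ → ℝ) (j : σ) :
    ∑ i, w i * refreshMatrix c v i j = (∑ i, w i) * (c * v j) + (1 - c) * w j := by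
  simp only [refreshMatrix_apply, mul_add, Finset.sum_add_distrib, ← Finset.sum_mul]
  congr 1
  simp [mul_comm]

/-- A sum over a class of states of the entropy terms of one column of a refresh chain. -/
theorem sum_mul_negMulLog_refreshMatrix {c : ℝ} {v : σ → ℝ} (s : Finset σ) (w : σ → ℝ) {j : σ}
    (hj : j ∈ s) :
    ∑ i ∈ s, w i * negMulLog (refreshMatrix c v i j) =
      w j * negMulLog (c * v j + (1 - c)) + ((∑ i ∈ s, w i) - w j) * negMulLog (c * v j) := by
  rw [← Finset.add_sum_erase _ _ hj, ← Finset.add_sum_erase s w hj, add_sub_cancel_left,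
    Finset.sum_mul]
  congr 1
  · simp [refreshMatrix_apply]
  · refine Finset.sum_congr rfl fun i hi => ?_
    simp [refreshMatrix_apply, Finset.ne_of_mem_erase hi]

theorem irreducibleMatrix_refreshMatrix {c : ℝ} (hc : 0 < c) (hc1 : c ≤ 1) {v : σ → ℝ}
    (hv : ∀ x, 0 < v x) : IrreducibleMatrix (refreshMatrix c v) := by
  rintro ⟨A, ⟨i, hi⟩, hA, h⟩
  obtain ⟨j, hj⟩ := (Set.ne_univ_iff_exists_notMem A).1 hA
  exact (refreshMatrix_pos hc hc1 hv i j).ne' (h i hi j hj)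

variable [Fintype σ]

theorem matrixEntropy_refreshMatrix {c : ℝ} {v : σ → ℝ} (h1 : ∑ x, v x = 1) :
    matrixEntropy (refreshMatrix c v) v = refreshRate c v := by
  unfold matrixEntropy refreshRate refreshEntropy
  simp_rw [← Finset.sum_div, ← mul_div_assoc, ← Finset.sum_div, Finset.mul_sum]
  rw [Finset.sum_comm]
  congr 1
  refine Finset.sum_congr rfl fun j _ => ?_
  rw [sum_mul_negMulLog_refreshMatrix _ _ (Finset.mem_univ j), h1]

theorem isInvariantDistribution_refreshMatrix {c : ℝ} {v : σ → ℝ} (hv : ∀ x, 0 ≤ v x)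
    (h1 : ∑ x, v x = 1) : IsInvariantDistribution (refreshMatrix c v) v :=
  ⟨hv, h1, fun j => by rw [sum_mul_refreshMatrix, h1]; ring⟩

theorem IsInvariantDistribution.eq_of_refreshMatrix {c : ℝ} (hc : c ≠ 0) {v w : σ → ℝ}
    (h : IsInvariantDistribution (refreshMatrix c v) w) : w = v := by
  funext j
  have := h.2.2 j
  rw [sum_mul_refreshMatrix, h.2.1] at this
  exact mul_left_cancel₀ hc (by linarith)

end Matrix

end RefreshEntropy

/-! ### Finite histories of a Markov chain -/

section History

variable {Ω : Type*} [MeasurableSpace Ω] {μ : Measure Ω} {σ τ : Type*}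

/-- The first `n` values of a process, as one random variable. -/
def history (X : ℕ → Ω → σ) (n : ℕ) (ω : Ω) : Fin n → σ := fun i => X i ω

/-- The probability of a given beginning of the process. -/
def histProb (μ : Measure Ω) (X : ℕ → Ω → σ) (n : ℕ) (a : Fin n → σ) : ℝ :=
  μ.real (history X n ⁻¹' {a})

theorem histProb_nonneg (X : ℕ → Ω → σ) (n : ℕ) (a : Fin n → σ) : 0 ≤ histProb μ X n a :=
  measureReal_nonneg

theorem measurableSet_history {X : ℕ → Ω → σ} (hX : ∀ n a, MeasurableSet (X n ⁻¹' {a})) (n : ℕ)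
    (a : Fin n → σ) : MeasurableSet (history X n ⁻¹' {a}) := by
  have : history X n ⁻¹' {a} = ⋂ i : Fin n, X i ⁻¹' {a i} := by
    ext ω
    simp [history, funext_iff]
  rw [this]
  exact MeasurableSet.iInter fun i => hX i (a i)

theorem sum_pi_snoc [Fintype σ] {M : Type*} [AddCommMonoid M] (n : ℕ)
    (Φ : (Fin (n + 1) → σ) → M) :
    ∑ a, Φ a = ∑ a : Fin n → σ, ∑ j, Φ (Fin.snoc (α := fun _ => σ) a j) := by
  rw [← (Fin.snocEquiv fun _ => σ).sum_comp, Fintype.sum_prod_type, Finset.sum_comm]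
  rfl

theorem real_history_mem [IsFiniteMeasure μ] {X : ℕ → Ω → σ}
    (hX : ∀ n a, MeasurableSet (X n ⁻¹' {a})) (n : ℕ) (s : Finset (Fin n → σ)) :
    μ.real {ω | history X n ω ∈ s} = ∑ a ∈ s, histProb μ X n a :=
  (sum_measureReal_preimage_singleton s fun a _ => measurableSet_history hX n a).symm

variable [Fintype σ]

theorem sum_histProb [IsProbabilityMeasure μ] {X : ℕ → Ω → σ}
    (hX : ∀ n a, MeasurableSet (X n ⁻¹' {a})) (n : ℕ) : ∑ a, histProb μ X n a = 1 := by
  classical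
  rw [← real_history_mem hX]
  simp

namespace IsMarkovChain

variable {X : ℕ → Ω → σ} {P : Matrix σ σ ℝ}

theorem histProb_snoc (h : IsMarkovChain μ X P) (n : ℕ) (a : Fin (n + 1) → σ) (j : σ) :
    histProb μ X (n + 2) (Fin.snoc (α := fun _ => σ) a j) =
      histProb μ X (n + 1) a * P (a (Fin.last n)) j := by
  have key := h.transition n fun k => if hk : k < n + 1 then a ⟨k, hk⟩ else j
  have e1 : history X (n + 2) ⁻¹' {Fin.snoc (α := fun _ => σ) a j} =
      {ω | ∀ i ≤ n + 1, X i ω = if hk : i < n + 1 then a ⟨i, hk⟩ else j} := by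
    ext ω
    simp only [Set.mem_preimage, Set.mem_singleton_iff, funext_iff, history, Set.mem_ofPred_eq]
    refine ⟨fun H i hi => by simpa [Fin.snoc, Fin.castLT] using H ⟨i, by omega⟩, fun H i => ?_⟩
    simpa [Fin.snoc, Fin.castLT] using H i (by omega)
  have e2 : history X (n + 1) ⁻¹' {a} =
      {ω | ∀ i ≤ n, X i ω = if hk : i < n + 1 then a ⟨i, hk⟩ else j} := by
    ext ω
    simp only [Set.mem_preimage, Set.mem_singleton_iff, funext_iff, history, Set.mem_ofPred_eq]
    refine ⟨fun H i hi => ?_, fun H i => ?_⟩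
    · rw [dif_pos (by omega)]
      exact H ⟨i, by omega⟩
    · have := H i (by omega)
      rwa [dif_pos i.2] at this
  rw [histProb, histProb, e1, e2, key]
  simp [Fin.last]

/-- Conditioning on the last step. -/
theorem sum_histProb_mul (h : IsMarkovChain μ X P) (n : ℕ) (Φ : (Fin (n + 2) → σ) → ℝ) :
    ∑ a, histProb μ X (n + 2) a * Φ a = ∑ a : Fin (n + 1) → σ, histProb μ X (n + 1) a *
      ∑ j, P (a (Fin.last n)) j * Φ (Fin.snoc (α := fun _ => σ) a j) := by
  rw [sum_pi_snoc]
  refine Finset.sum_congr rfl fun a _ => ?_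
  rw [Finset.mul_sum]
  refine Finset.sum_congr rfl fun j _ => ?_
  rw [h.histProb_snoc, mul_assoc]

variable [IsProbabilityMeasure μ]

/-- Expectations of functions of the last state. -/
theorem sum_histProb_last (h : IsMarkovChain μ X P) (n : ℕ) (F : σ → ℝ) :
    ∑ a : Fin (n + 1) → σ, histProb μ X (n + 1) a * F (a (Fin.last n)) =
      ∑ x, μ.real (X n ⁻¹' {x}) * F x := by
  classical
  have e : ∀ x, μ.real (X n ⁻¹' {x}) =
      ∑ a : Fin (n + 1) → σ with a (Fin.last n) = x, histProb μ X (n + 1) a := by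
    intro x
    rw [← real_history_mem h.measurable]
    congr 1
    ext ω
    simp [history]
  simp_rw [e, Finset.sum_mul]
  rw [← Finset.sum_fiberwise Finset.univ fun a : Fin (n + 1) → σ => a (Fin.last n)]
  refine Finset.sum_congr rfl fun x _ => Finset.sum_congr rfl fun a ha => ?_
  rw [(Finset.mem_filter.1 ha).2]

theorem real_preimage_pair (h : IsMarkovChain μ X P) (n : ℕ) (x y : σ) :
    μ.real ((fun ω => (X (n + 1) ω, X n ω)) ⁻¹' {(y, x)}) = μ.real (X n ⁻¹' {x}) * P x y := by
  classical
  have e : μ.real ((fun ω => (X (n + 1) ω, X n ω)) ⁻¹' {(y, x)}) =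
      ∑ a : Fin (n + 2) → σ, histProb μ X (n + 2) a *
        if a (Fin.last n).castSucc = x ∧ a (Fin.last (n + 1)) = y then 1 else 0 := by
    simp only [mul_ite, mul_one, mul_zero]
    rw [← Finset.sum_filter, ← real_history_mem h.measurable]
    congr 1
    ext ω
    simp [history, and_comm]
  rw [e, h.sum_histProb_mul]
  simp only [Fin.snoc_castSucc, Fin.snoc_last, mul_ite, mul_one, mul_zero]
  rw [h.sum_histProb_last n fun x' => ∑ j, if x' = x ∧ j = y then P x' j else 0]
  simp [ite_and]

theorem real_preimage_succ (h : IsMarkovChain μ X P) (n : ℕ) (y : σ) :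
    μ.real (X (n + 1) ⁻¹' {y}) = ∑ x, μ.real (X n ⁻¹' {x}) * P x y := by
  classical
  rw [← h.sum_histProb_last n fun x => P x y]
  have := h.sum_histProb_last (n + 1) fun x => if x = y then 1 else 0
  simp only [mul_ite, mul_one, mul_zero, Finset.sum_ite_eq', Finset.mem_univ, if_true] at this
  rw [← this]
  have := h.sum_histProb_mul n fun a => if a (Fin.last (n + 1)) = y then 1 else 0
  simpa using this

theorem sum_real_preimage (h : IsMarkovChain μ X P) (n : ℕ) : ∑ x, μ.real (X n ⁻¹' {x}) = 1 := by
  rw [sum_measureReal_preimage_singleton _ fun x _ => h.measurable n x]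
  simp

/-- A process has at most one transition matrix if one of its transition matrices has positive
entries: all states are then visited at time `1` with positive probability, whatever the initial
distribution. -/
theorem eq_of_pos (h : IsMarkovChain μ X P) {Q : Matrix σ σ ℝ} (hQ : IsMarkovChain μ X Q)
    (hpos : ∀ i j, 0 < Q i j) : P = Q := by
  ext i j
  have hi : 0 < μ.real (X 1 ⁻¹' {i}) := by
    rw [hQ.real_preimage_succ]
    obtain ⟨x, -, hx⟩ : ∃ x ∈ Finset.univ, 0 < μ.real (X 0 ⁻¹' {x}) := by
      by_contra! H
      have := Finset.sum_nonpos H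
      rw [h.sum_real_preimage] at this
      norm_num at this
    exact Finset.sum_pos' (fun y _ => mul_nonneg measureReal_nonneg (hpos y i).le)
      ⟨x, Finset.mem_univ x, mul_pos hx (hpos x i)⟩
  have h1 := h.real_preimage_pair 1 i j
  rw [hQ.real_preimage_pair] at h1
  exact (mul_left_cancel₀ hi.ne' h1).symm

/-- A strongly lumpable chain stays Markovian after lumping. -/
theorem lump [Fintype τ] [DecidableEq τ] (h : IsMarkovChain μ X P) (e : σ → τ)
    {Q : Matrix τ τ ℝ} (hQ : ∀ x b, ∑ y with e y = b, P x y = Q (e x) b)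
    (h0 : ∀ i j, 0 ≤ Q i j) (h1 : ∀ i, ∑ j, Q i j = 1) :
    IsMarkovChain μ (fun n ω => e (X n ω)) Q where
  measurable n b := by
    have : (fun ω => e (X n ω)) ⁻¹' {b} = ⋃ x ∈ {x | e x = b}, X n ⁻¹' {x} := by
      ext ω; simp
    rw [this]
    exact (Set.toFinite _).measurableSet_biUnion fun x _ => h.measurable n x
  nonneg := h0
  row_sum := h1
  transition n b := by
    classical
    have e1 : ∀ m, μ.real {ω | ∀ i ≤ m, e (X i ω) = b i} = ∑ a : Fin (m + 1) → σ,
        histProb μ X (m + 1) a * if ∀ i, e (a i) = b i then 1 else 0 := by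
      intro m
      simp only [mul_ite, mul_one, mul_zero]
      rw [← Finset.sum_filter, ← real_history_mem h.measurable]
      congr 1
      ext ω
      simp only [history, Set.mem_ofPred_eq, Finset.mem_filter, Finset.mem_univ, true_and]
      exact ⟨fun H i => H i (by omega), fun H i hi => H ⟨i, by omega⟩⟩
    rw [e1, e1, h.sum_histProb_mul, Finset.sum_mul]
    refine Finset.sum_congr rfl fun a _ => ?_
    rw [mul_assoc]
    congr 1
    have e2 : ∀ j, (∀ i, e ((Fin.snoc (α := fun _ => σ) a j : Fin (n + 2) → σ) i) = b i) ↔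
        (∀ i, e (a i) = b i) ∧ e j = b (n + 1) := by
      intro j
      rw [Fin.forall_fin_succ']
      simp
    simp only [e2]
    by_cases ha : ∀ i, e (a i) = b i
    · have hlast : e (a (Fin.last n)) = b n := by simpa using ha (Fin.last n)
      simp only [ha, implies_true, true_and, if_true, one_mul, mul_ite, mul_one, mul_zero]
      rw [← Finset.sum_filter, hQ, hlast]
    · simp [ha]

end IsMarkovChain

/-! ### Entropy of a Markov chain -/

theorem entropy_eq_sum {α : Type*} [Fintype α] (W : Ω → α) :
    entropy μ W = ∑ a, negMulLog (μ.real (W ⁻¹' {a})) / Real.log 2 :=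
  finsum_eq_sum_of_fintype _

theorem entropy_of_subsingleton [IsProbabilityMeasure μ] {α : Type*} [Finite α] [Subsingleton α]
    (W : Ω → α) : entropy μ W = 0 := by
  unfold entropy
  refine finsum_eq_zero_of_forall_eq_zero fun a => ?_
  have : W ⁻¹' {a} = Set.univ := by
    ext ω
    simpa using Subsingleton.elim (W ω) a
  simp [this]

/-- The entropy, in bits, of the next state when the current state is `x`. -/
def rowEntropy (P : Matrix σ σ ℝ) (x : σ) : ℝ := ∑ j, negMulLog (P x j) / Real.log 2

theorem sum_negMulLog_mul {P : Matrix σ σ ℝ} (hP : ∀ i, ∑ j, P i j = 1) (w : ℝ) (x : σ) :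
    ∑ j, negMulLog (w * P x j) / Real.log 2 =
      negMulLog w / Real.log 2 + w * rowEntropy P x := by
  simp_rw [Real.negMulLog_mul, add_div, Finset.sum_add_distrib, mul_div_assoc, ← Finset.sum_mul,
    rowEntropy, Finset.mul_sum, hP, one_mul]

namespace IsMarkovChain

variable [IsProbabilityMeasure μ] {X : ℕ → Ω → σ} {P : Matrix σ σ ℝ}

theorem entropy_history_succ (h : IsMarkovChain μ X P) (n : ℕ) :
    entropy μ (history X (n + 2)) =
      entropy μ (history X (n + 1)) + ∑ x, μ.real (X n ⁻¹' {x}) * rowEntropy P x := by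
  rw [entropy_eq_sum, entropy_eq_sum, sum_pi_snoc, ← h.sum_histProb_last,
    ← Finset.sum_add_distrib]
  refine Finset.sum_congr rfl fun a _ => ?_
  refine Eq.trans (Finset.sum_congr rfl fun j _ => ?_)
    (sum_negMulLog_mul h.row_sum (histProb μ X (n + 1) a) (a (Fin.last n)))
  rw [← h.histProb_snoc]
  rfl

theorem condEntropy_succ (h : IsMarkovChain μ X P) (n : ℕ) :
    condEntropy μ (X (n + 1)) (X n) = ∑ x, μ.real (X n ⁻¹' {x}) * rowEntropy P x := by
  rw [condEntropy, entropy_eq_sum, entropy_eq_sum, Fintype.sum_prod_type, Finset.sum_comm,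
    sub_eq_iff_eq_add', ← Finset.sum_add_distrib]
  refine Finset.sum_congr rfl fun x _ => ?_
  rw [← sum_negMulLog_mul h.row_sum]
  refine Finset.sum_congr rfl fun y _ => ?_
  rw [h.real_preimage_pair]

variable [DecidableEq σ] {c : ℝ} {v : σ → ℝ}

/-- Convergence to the invariant distribution: the deviation shrinks by the factor `1 - c` in each
step. -/
theorem tendsto_real_preimage (h : IsMarkovChain μ X (refreshMatrix c v)) (hc : 0 < c)
    (hc1 : c ≤ 1) (x : σ) : Tendsto (fun n => μ.real (X n ⁻¹' {x})) atTop (𝓝 (v x)) := by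
  have e : ∀ n, μ.real (X n ⁻¹' {x}) = v x + (1 - c) ^ n * (μ.real (X 0 ⁻¹' {x}) - v x) := by
    intro n
    induction n with
    | zero => ring
    | succ n ih =>
      rw [h.real_preimage_succ, sum_mul_refreshMatrix, h.sum_real_preimage, ih]
      ring
  refine Tendsto.congr (fun n => (e n).symm) ?_
  have := (tendsto_pow_atTop_nhds_zero_of_lt_one (by linarith : 0 ≤ 1 - c)
    (by linarith)).mul_const (μ.real (X 0 ⁻¹' {x}) - v x)
  simpa using this.const_add (v x)

theorem tendsto_sum_rowEntropy (h : IsMarkovChain μ X (refreshMatrix c v)) (hc : 0 < c)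
    (hc1 : c ≤ 1) (h1 : ∑ x, v x = 1) :
    Tendsto (fun n => ∑ x, μ.real (X n ⁻¹' {x}) * rowEntropy (refreshMatrix c v) x) atTop
      (𝓝 (refreshRate c v)) := by
  rw [← matrixEntropy_refreshMatrix h1]
  exact tendsto_finsetSum _ fun x _ => (h.tendsto_real_preimage hc hc1 x).mul_const _

theorem tendsto_condEntropy (h : IsMarkovChain μ X (refreshMatrix c v)) (hc : 0 < c)
    (hc1 : c ≤ 1) (h1 : ∑ x, v x = 1) :
    Tendsto (fun n => condEntropy μ (X (n + 1)) (X n)) atTop (𝓝 (refreshRate c v)) := by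
  simp_rw [h.condEntropy_succ]
  exact h.tendsto_sum_rowEntropy hc hc1 h1

/-- The entropy rate of the process, as a Cesàro limit of conditional entropies. -/
theorem tendsto_entropy_history (h : IsMarkovChain μ X (refreshMatrix c v)) (hc : 0 < c)
    (hc1 : c ≤ 1) (h1 : ∑ x, v x = 1) :
    Tendsto (fun n : ℕ => (1 / (n : ℝ)) * entropy μ (history X n)) atTop
      (𝓝 (refreshRate c v)) := by
  have key : Tendsto (fun n => entropy μ (history X (n + 1)) - entropy μ (history X n)) atTop
      (𝓝 (refreshRate c v)) := by
    rw [← tendsto_add_atTop_iff_nat 1]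
    refine (h.tendsto_sum_rowEntropy hc hc1 h1).congr fun n => ?_
    rw [h.entropy_history_succ]
    ring
  refine key.cesaro.congr fun n => ?_
  rw [Finset.sum_range_sub fun n => entropy μ (history X n),
    entropy_of_subsingleton (history X 0), sub_zero, one_div]

theorem lump_refreshMatrix [Fintype τ] [DecidableEq τ] (h : IsMarkovChain μ X (refreshMatrix c v))
    (hc : 0 ≤ c) (hc1 : c ≤ 1) (hv : ∀ x, 0 ≤ v x) (h1 : ∑ x, v x = 1) (e : σ → τ) :
    IsMarkovChain μ (fun n ω => e (X n ω)) (refreshMatrix c (pushDist v e)) := by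
  refine h.lump e (fun x b => ?_) (refreshMatrix_nonneg hc hc1 (pushDist_nonneg hv e))
    (sum_refreshMatrix (by rw [sum_pushDist, h1]))
  simp only [refreshMatrix_apply, Finset.sum_add_distrib, ← Finset.mul_sum, pushDist]
  congr 2
  simp [Finset.sum_ite_eq]

end IsMarkovChain

end History

/-! ### Typical sequences of a Markov chain -/

section Typical

variable {Ω : Type*} [MeasurableSpace Ω] {μ : Measure Ω} {σ τ : Type*}

/-- The sum of `f` over the transitions of a path of `n` steps. -/
def pathSum (f : σ → σ → ℝ) (n : ℕ) (a : Fin (n + 1) → σ) : ℝ :=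
  ∑ i : Fin n, f (a i.castSucc) (a i.succ)

theorem pathSum_snoc (f : σ → σ → ℝ) (n : ℕ) (a : Fin (n + 1) → σ) (j : σ) :
    pathSum f (n + 1) (Fin.snoc (α := fun _ => σ) a j) =
      pathSum f n a + f (a (Fin.last n)) j := by
  rw [pathSum, Fin.sum_univ_castSucc, pathSum]
  congr 1
  · refine Finset.sum_congr rfl fun i _ => ?_
    rw [Fin.snoc_castSucc, Fin.succ_castSucc, Fin.snoc_castSucc]
  · rw [Fin.snoc_castSucc, Fin.succ_last, Fin.snoc_last]

variable [Fintype σ]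

/-- If `G` solves the Poisson equation `P G - G = L - ∑ j, P i j * f i j`, then
`∑ f - n L + G` is a martingale with bounded increments, whence a linear bound for the second
moment. -/
theorem IsMarkovChain.exists_sum_histProb_mul_sq_le [IsProbabilityMeasure μ] {X : ℕ → Ω → σ}
    {P : Matrix σ σ ℝ} (h : IsMarkovChain μ X P) (f : σ → σ → ℝ) (G : σ → ℝ) (L : ℝ)
    (hG : ∀ i, ∑ j, P i j * (f i j + G j) = G i + L) :
    ∃ C, ∀ n : ℕ, ∑ a, histProb μ X (n + 1) a * (pathSum f n a - n * L) ^ 2 ≤ (n + 1) * C := by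
  set D : σ → σ → ℝ := fun i j => f i j - L + G j - G i with hD
  set C : ℝ := ∑ i, ∑ j, D i j ^ 2 + ∑ i, G i ^ 2 with hC
  have hC1 : ∀ i j, D i j ^ 2 ≤ C := fun i j => by
    have h1 := Finset.single_le_sum (f := fun j => D i j ^ 2) (fun j _ => sq_nonneg _)
      (Finset.mem_univ j)
    have h2 := Finset.single_le_sum (f := fun i => ∑ j, D i j ^ 2)
      (fun i _ => Finset.sum_nonneg fun j _ => sq_nonneg _) (Finset.mem_univ i)
    have h3 : 0 ≤ ∑ i, G i ^ 2 := Finset.sum_nonneg fun i _ => sq_nonneg _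
    linarith
  have hC2 : ∀ i, G i ^ 2 ≤ C := fun i => by
    have h1 := Finset.single_le_sum (f := fun i => G i ^ 2) (fun i _ => sq_nonneg _)
      (Finset.mem_univ i)
    have h2 : 0 ≤ ∑ i, ∑ j, D i j ^ 2 :=
      Finset.sum_nonneg fun i _ => Finset.sum_nonneg fun j _ => sq_nonneg _
    linarith
  have hC0 : 0 ≤ C := by
    rw [hC]
    positivity
  have hD0 : ∀ i, ∑ j, P i j * D i j = 0 := fun i => by
    have : ∀ j, P i j * D i j = P i j * (f i j + G j) - P i j * (L + G i) := fun j => by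
      simp only [hD]; ring
    simp_rw [this, Finset.sum_sub_distrib, hG, ← Finset.sum_mul, h.row_sum]
    ring
  have mart : ∀ n : ℕ, ∑ a, histProb μ X (n + 1) a *
      (pathSum f n a - n * L + G (a (Fin.last n))) ^ 2 ≤ (n + 1) * C := by
    intro n
    induction n with
    | zero =>
      calc _ ≤ ∑ a, histProb μ X 1 a * C := Finset.sum_le_sum fun a _ => by
            refine mul_le_mul_of_nonneg_left ?_ (histProb_nonneg _ _ _)
            simpa [pathSum] using hC2 _
        _ = _ := by rw [← Finset.sum_mul, sum_histProb h.measurable]; simp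
    | succ n ih =>
      rw [h.sum_histProb_mul]
      have step : ∀ a : Fin (n + 1) → σ, ∑ j, P (a (Fin.last n)) j *
          (pathSum f (n + 1) (Fin.snoc (α := fun _ => σ) a j) - ((n + 1 : ℕ) : ℝ) * L +
            G (Fin.snoc (α := fun _ => σ) a j (Fin.last (n + 1)))) ^ 2 ≤
          (pathSum f n a - n * L + G (a (Fin.last n))) ^ 2 + C := by
        intro a
        set i := a (Fin.last n)
        set S := pathSum f n a - n * L + G i with hS
        have e : ∀ j, P i j *
            (pathSum f (n + 1) (Fin.snoc (α := fun _ => σ) a j) - ((n + 1 : ℕ) : ℝ) * L +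
              G (Fin.snoc (α := fun _ => σ) a j (Fin.last (n + 1)))) ^ 2 =
            P i j * S ^ 2 + 2 * S * (P i j * D i j) + P i j * D i j ^ 2 := by
          intro j
          rw [pathSum_snoc, Fin.snoc_last]
          push_cast
          simp only [hS, hD]
          ring
        simp_rw [e, Finset.sum_add_distrib, ← Finset.mul_sum, ← Finset.sum_mul, hD0, h.row_sum]
        have : ∑ j, P i j * D i j ^ 2 ≤ ∑ j, P i j * C :=
          Finset.sum_le_sum fun j _ => mul_le_mul_of_nonneg_left (hC1 i j) (h.nonneg i j)
        rw [← Finset.sum_mul, h.row_sum] at this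
        linarith
      calc _ ≤ ∑ a, histProb μ X (n + 1) a *
            ((pathSum f n a - n * L + G (a (Fin.last n))) ^ 2 + C) :=
            Finset.sum_le_sum fun a _ => mul_le_mul_of_nonneg_left (step a) (histProb_nonneg _ _ _)
        _ ≤ _ := by
            simp_rw [mul_add, Finset.sum_add_distrib, ← Finset.sum_mul,
              sum_histProb h.measurable]
            push_cast
            linarith
  -- the bounded term `G` is removed at the expense of a larger constant
  refine ⟨4 * C, fun n => ?_⟩
  calc _ ≤ ∑ a, histProb μ X (n + 1) a *
        (2 * (pathSum f n a - n * L + G (a (Fin.last n))) ^ 2 + 2 * C) :=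
        Finset.sum_le_sum fun a _ => by
          refine mul_le_mul_of_nonneg_left ?_ (histProb_nonneg _ _ _)
          nlinarith [hC2 (a (Fin.last n)),
            sq_nonneg (pathSum f n a - n * L + 2 * G (a (Fin.last n)))]
    _ = 2 * ∑ a, histProb μ X (n + 1) a *
        (pathSum f n a - n * L + G (a (Fin.last n))) ^ 2 + 2 * C := by
        simp_rw [mul_add, Finset.sum_add_distrib, ← Finset.sum_mul, sum_histProb h.measurable,
          one_mul, Finset.mul_sum]
        congr 1
        refine Finset.sum_congr rfl fun a _ => by ring
    _ ≤ _ := by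
        have := mart n
        have : 0 ≤ n * C := by positivity
        linarith

open Classical in
/-- Weak law of large numbers for the transitions of a refresh chain. -/
theorem IsMarkovChain.tendsto_real_pathSum [IsProbabilityMeasure μ] [DecidableEq σ]
    {X : ℕ → Ω → σ} {c : ℝ} {v : σ → ℝ} (h : IsMarkovChain μ X (refreshMatrix c v)) (hc : c ≠ 0)
    (h1 : ∑ x, v x = 1) (f : σ → σ → ℝ) {L δ : ℝ} (hδ : 0 < δ)
    (hL : ∑ i, v i * ∑ j, refreshMatrix c v i j * f i j = L) :
    Tendsto (fun n : ℕ => μ.real {ω | n * δ ≤ |pathSum f n (history X (n + 1) ω) - n * L|})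
      atTop (𝓝 0) := by
  set F : σ → ℝ := fun i => ∑ j, refreshMatrix c v i j * f i j with hF
  have hL' : ∑ i, v i * F i = L := hL
  -- `F - L` is an eigenfunction of the transition matrix, with eigenvalue `1 - c`
  obtain ⟨C, hC⟩ := h.exists_sum_histProb_mul_sq_le f (fun i => (F i - L) / c) L fun i => by
    simp_rw [mul_add, Finset.sum_add_distrib]
    have : ∑ j, refreshMatrix c v i j * ((F j - L) / c) = (1 - c) * ((F i - L) / c) := by
      simp only [refreshMatrix_apply, add_mul, Finset.sum_add_distrib]
      have e : ∀ j, c * v j * ((F j - L) / c) = v j * F j - v j * L := fun j => by field_simp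
      simp_rw [e, Finset.sum_sub_distrib, ← Finset.sum_mul, h1, hL']
      simp
    rw [this]
    change F i + _ = _
    field_simp
    ring
  have hlim : Tendsto (fun n : ℕ => ((n : ℝ) + 1) * C / (n * δ) ^ 2) atTop (𝓝 0) := by
    have e : ∀ n : ℕ, ((n : ℝ) + 1) * C / (n * δ) ^ 2 =
        C / δ ^ 2 * ((n : ℝ)⁻¹ + (n : ℝ)⁻¹ * (n : ℝ)⁻¹) := by
      intro n
      rcases eq_or_ne (n : ℝ) 0 with hn | hn
      · simp [hn]
      · field_simp
    simp_rw [e]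
    have := tendsto_inv_atTop_nhds_zero_nat (𝕜 := ℝ)
    simpa using (this.add (this.mul this)).const_mul (C / δ ^ 2)
  refine tendsto_of_tendsto_of_tendsto_of_le_of_le' tendsto_const_nhds hlim
    (Eventually.of_forall fun n => measureReal_nonneg) ?_
  filter_upwards [eventually_gt_atTop 0] with n hn
  have hn' : (0 : ℝ) < n := by exact_mod_cast hn
  rw [le_div_iff₀ (by positivity)]
  refine le_trans ?_ (hC n)
  have e := real_history_mem (μ := μ) h.measurable (n + 1)
    (Finset.univ.filter fun a => n * δ ≤ |pathSum f n a - n * L|)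
  simp only [Finset.mem_filter, Finset.mem_univ, true_and] at e
  rw [e, Finset.sum_mul, Finset.sum_filter]
  refine Finset.sum_le_sum fun a _ => ?_
  split_ifs with ha
  · refine mul_le_mul_of_nonneg_left ?_ (histProb_nonneg _ _ _)
    rw [← sq_abs (pathSum f n a - n * L)]
    gcongr
  · exact mul_nonneg (histProb_nonneg _ _ _) (sq_nonneg _)

/-- The total weight of all paths over a given path of the lumped chain; the weight of a path is
its probability given its first state. -/
theorem sum_exp_neg_pathSum_le [DecidableEq τ] {P : Matrix σ σ ℝ} {Q : Matrix τ τ ℝ}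
    (e : σ → τ) (hP : ∀ i j, 0 < P i j) (hpos : ∀ i j, 0 < Q i j)
    (hQ : ∀ x b, ∑ y with e y = b, P x y = Q (e x) b)
    (n : ℕ) (b : Fin (n + 1) → τ) :
    ∑ a : Fin (n + 1) → σ with e ∘ a = b, Real.exp (-pathSum (fun i j => -Real.log (P i j)) n a) ≤
      Fintype.card σ * Real.exp (-pathSum (fun i j => -Real.log (Q i j)) n b) := by
  induction n with
  | zero =>
    simp only [pathSum, Finset.univ_eq_empty, Finset.sum_empty, neg_zero, Real.exp_zero,
      Finset.sum_const, nsmul_eq_mul, mul_one]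
    exact_mod_cast (Finset.card_le_univ _).trans (by simp)
  | succ n ih =>
    obtain ⟨b, j, rfl⟩ : ∃ (b' : Fin (n + 1) → τ) (j : τ),
        b = Fin.snoc (α := fun _ => τ) b' j :=
      ⟨_, _, (Fin.snoc_init_self b).symm⟩
    rw [Finset.sum_filter, sum_pi_snoc]
    have hiff : ∀ (a : Fin (n + 1) → σ) (i : σ),
        e ∘ Fin.snoc (α := fun _ => σ) a i = Fin.snoc (α := fun _ => τ) b j ↔
          e ∘ a = b ∧ e i = j := by
      intro a i
      simp only [funext_iff, Function.comp]
      rw [Fin.forall_fin_succ']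
      simp
    simp only [hiff, pathSum_snoc, neg_add, neg_neg, Real.exp_add, Real.exp_log (hP _ _),
      Real.exp_log (hpos _ _)]
    rw [← mul_assoc]
    refine le_trans (le_of_eq ?_) (mul_le_mul_of_nonneg_right (ih b) (hpos _ _).le)
    rw [Finset.sum_mul, Finset.sum_filter]
    refine Finset.sum_congr rfl fun a _ => ?_
    split_ifs with ha
    · subst ha
      simp only [true_and]
      rw [Function.comp, ← hQ, Finset.mul_sum, Finset.sum_filter]
    · simp [ha]

open Classical in
/-- Joint typicality for a chain `X` and a lumping `e` of it: there are sets of paths, of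
asymptotically full probability, that contain about `exp (n H)` paths, of which about
`exp (n (H - H'))` lie over one path of the lumped chain; `H` and `H'` are the entropy rates
of the two chains in nats. -/
theorem IsMarkovChain.exists_typicalSet [IsProbabilityMeasure μ] [DecidableEq σ] [Fintype τ]
    [DecidableEq τ] {X : ℕ → Ω → σ} {c : ℝ} {v : σ → ℝ}
    (h : IsMarkovChain μ X (refreshMatrix c v)) (hc : 0 < c) (hc1 : c ≤ 1)
    (hv : ∀ x, 0 < v x) (h1 : ∑ x, v x = 1) {e : σ → τ} (he : Function.Surjective e)
    {δ : ℝ} (hδ : 0 < δ) :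
    ∃ T : ∀ n : ℕ, Finset (Fin (n + 1) → σ),
      Tendsto (fun n => μ.real {ω | history X (n + 1) ω ∉ T n}) atTop (𝓝 0) ∧
      ∀ n : ℕ,
        ((T n).card : ℝ) ≤
          Fintype.card σ * Real.exp (n * (refreshRate c v * Real.log 2 + δ)) ∧
        ∀ a ∈ T n, (((T n).filter fun a' => e ∘ a' = e ∘ a).card : ℝ) ≤
          Fintype.card σ * Real.exp (n * ((refreshRate c v - refreshRate c (pushDist v e)) *
            Real.log 2 + 2 * δ)) := by
  have hlog : Real.log 2 ≠ 0 := (Real.log_pos (by norm_num)).ne'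
  set P := refreshMatrix c v with hPdef
  set w := pushDist v e with hw
  set Q := refreshMatrix c w with hQdef
  have hw0 : ∀ y, 0 < w y := fun y => by
    obtain ⟨x, rfl⟩ := he y
    exact pushDist_pos hv e x
  have hw1 : ∑ y, w y = 1 := by rw [hw, sum_pushDist, h1]
  have hP : ∀ i j, 0 < P i j := refreshMatrix_pos hc hc1 hv
  have hQ : ∀ i j, 0 < Q i j := refreshMatrix_pos hc hc1 hw0
  have hPQ : ∀ x b, ∑ y with e y = b, P x y = Q (e x) b := by
    intro x b
    simp only [hPdef, hQdef, refreshMatrix_apply, Finset.sum_add_distrib, ← Finset.mul_sum,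
      hw, pushDist]
    congr 2
    simp [Finset.sum_ite_eq]
  set f : σ → σ → ℝ := fun i j => -Real.log (P i j) with hf
  set f₀ : τ → τ → ℝ := fun i j => -Real.log (Q i j) with hf₀
  set f' : σ → σ → ℝ := fun i j => f₀ (e i) (e j) with hf'
  set L := refreshRate c v * Real.log 2 with hLdef
  set L' := refreshRate c w * Real.log 2 with hLdef'
  have hL : ∑ i, v i * ∑ j, P i j * f i j = L := by
    rw [hLdef, ← matrixEntropy_refreshMatrix h1, matrixEntropy, Finset.sum_mul]
    refine Finset.sum_congr rfl fun i _ => ?_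
    rw [mul_assoc, Finset.sum_mul]
    congr 1
    refine Finset.sum_congr rfl fun j _ => ?_
    rw [div_mul_cancel₀ _ hlog, negMulLog]
    simp only [hf, hPdef]
    ring
  have hL' : ∑ i, v i * ∑ j, P i j * f' i j = L' := by
    have e1 : ∀ i, ∑ j, P i j * f' i j = ∑ b, Q (e i) b * f₀ (e i) b := by
      intro i
      rw [← Finset.sum_fiberwise Finset.univ e]
      refine Finset.sum_congr rfl fun b _ => ?_
      rw [← hPQ, Finset.sum_mul]
      refine Finset.sum_congr rfl fun j hj => ?_
      simp only [hf', (Finset.mem_filter.1 hj).2]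
    simp_rw [e1]
    rw [← Finset.sum_fiberwise Finset.univ e, hLdef', ← matrixEntropy_refreshMatrix hw1,
      matrixEntropy, Finset.sum_mul]
    refine Finset.sum_congr rfl fun y _ => ?_
    have e2 : ∑ i with e i = y, v i * ∑ b, Q (e i) b * f₀ (e i) b =
        ∑ i with e i = y, v i * ∑ b, Q y b * f₀ y b :=
      Finset.sum_congr rfl fun i hi => by rw [(Finset.mem_filter.1 hi).2]
    have e3 : ∑ i with e i = y, v i * ∑ b, Q y b * f₀ y b = w y * ∑ b, Q y b * f₀ y b :=
      (Finset.sum_mul _ _ _).symm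
    rw [e2, e3, mul_assoc, Finset.sum_mul]
    congr 1
    refine Finset.sum_congr rfl fun b _ => ?_
    rw [div_mul_cancel₀ _ hlog, negMulLog]
    simp only [hf₀, hQdef]
    ring
  have hpath : ∀ (n : ℕ) (a : Fin (n + 1) → σ), pathSum f' n a = pathSum f₀ n (e ∘ a) :=
    fun n a => rfl
  refine ⟨fun n => Finset.univ.filter fun a =>
    |pathSum f n a - n * L| < n * δ ∧ |pathSum f' n a - n * L'| < n * δ, ?_, fun n => ?_⟩
  · have t1 := h.tendsto_real_pathSum hc.ne' h1 f hδ hL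
    have t2 := h.tendsto_real_pathSum hc.ne' h1 f' hδ hL'
    have t := t1.add t2
    rw [add_zero] at t
    refine tendsto_of_tendsto_of_tendsto_of_le_of_le tendsto_const_nhds t
      (fun n => measureReal_nonneg) fun n => ?_
    refine (measureReal_mono ?_).trans (measureReal_union_le _ _)
    intro ω hω
    simp only [Set.mem_ofPred_eq, Finset.mem_filter, Finset.mem_univ, true_and, not_and_or,
      not_lt] at hω
    exact hω
  · -- every typical path has weight at least `exp (-n (L + δ))`
    have count : ∀ (s : Finset (Fin (n + 1) → σ)) (M : ℝ),
        (∀ a ∈ s, |pathSum f n a - n * L| < n * δ) →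
        ∑ a ∈ s, Real.exp (-pathSum f n a) ≤ M → (s.card : ℝ) ≤ M * Real.exp (n * (L + δ)) := by
      intro s M hs hM
      have : ∑ a ∈ s, Real.exp (-(n * (L + δ))) ≤ M := by
        refine le_trans (Finset.sum_le_sum fun a ha => ?_) hM
        have := (abs_lt.1 (hs a ha)).2
        exact Real.exp_le_exp.2 (by linarith)
      rw [Finset.sum_const, nsmul_eq_mul, Real.exp_neg] at this
      rwa [← div_le_iff₀ (Real.exp_pos _), div_eq_mul_inv]
    constructor
    · refine count _ _ (fun a ha => (Finset.mem_filter.1 ha).2.1) ?_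
      -- lumping all states into one shows that the weights of all paths sum to at most `card σ`
      have := sum_exp_neg_pathSum_le (P := P) (Q := fun _ _ : Unit => 1) (fun _ => ()) hP
        (fun _ _ => one_pos) (fun x b => by simpa using sum_refreshMatrix h1 x) n fun _ => ()
      refine le_trans (Finset.sum_le_sum_of_subset_of_nonneg ?_ fun a _ _ =>
        (Real.exp_pos _).le) (this.trans (by simp [pathSum]))
      intro a _
      simp
    · intro a ha
      have ha2 := (abs_lt.1 (Finset.mem_filter.1 ha).2.2).1
      have key : ∑ a' : Fin (n + 1) → σ with e ∘ a' = e ∘ a, Real.exp (-pathSum f n a') ≤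
          Fintype.card σ * Real.exp (-(n * (L' - δ))) := by
        refine (sum_exp_neg_pathSum_le e hP hQ hPQ n (e ∘ a)).trans ?_
        refine mul_le_mul_of_nonneg_left (Real.exp_le_exp.2 ?_) (by positivity)
        have := hpath n a
        change -pathSum f₀ n (e ∘ a) ≤ _
        rw [← this]
        linarith
      refine (count _ (Fintype.card σ * Real.exp (-(n * (L' - δ)))) (fun a ha =>
        (Finset.mem_filter.1 (Finset.mem_filter.1 ha).1).2.1) ?_).trans (le_of_eq ?_)
      · refine le_trans (Finset.sum_le_sum_of_subset_of_nonneg ?_ fun a _ _ =>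
          (Real.exp_pos _).le) key
        intro a' ha'
        simpa using (Finset.mem_filter.1 ha').2
      · rw [mul_assoc, ← Real.exp_add, sub_mul]
        congr 2
        ring

end Typical

/-! ### Random linear coding over `ZMod 4` -/

section Coding

/-- If some coordinate of `d` has `card κ` distinct multiples, then a uniformly random matrix with
`m` rows annihilates `d` with probability at most `(card κ) ^ (-m)`. -/
theorem card_mulVec_eq_zero_mul_le {R κ : Type*} [Ring R] [Fintype R] [DecidableEq R] [Fintype κ]
    {m n : ℕ} (d : Fin n → R) (i : Fin n) (s : κ → R)
    (hs : Function.Injective fun k => s k * d i) :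
    (Finset.univ.filter fun A : Matrix (Fin m) (Fin n) R => A.mulVec d = 0).card *
      Fintype.card κ ^ m ≤ Fintype.card (Matrix (Fin m) (Fin n) R) := by
  classical
  -- translates of the annihilator of `d` by matrices with different products with `d`
  let B : (Fin m → κ) → Matrix (Fin m) (Fin n) R :=
    fun b => Matrix.of fun l j => if j = i then s (b l) else 0
  have hB : ∀ b, (B b).mulVec d = fun l => s (b l) * d i := by
    intro b
    funext l
    simp [B, Matrix.mulVec, dotProduct]
  have hinj : Function.Injective
      fun p : {A : Matrix (Fin m) (Fin n) R // A.mulVec d = 0} × (Fin m → κ) =>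
        (p.1 : Matrix (Fin m) (Fin n) R) + B p.2 := by
    rintro ⟨⟨A, hA⟩, b⟩ ⟨⟨A', hA'⟩, b'⟩ hp
    simp only at hp
    have hbb : b = b' := by
      have := congrArg (fun M => Matrix.mulVec M d) hp
      simp only [Matrix.add_mulVec, hA, hA', zero_add, hB] at this
      funext l
      exact hs (congrFun this l)
    subst hbb
    simpa using hp
  have := Fintype.card_le_of_injective _ hinj
  rwa [Fintype.card_prod, Fintype.card_fun, Fintype.card_subtype, Fintype.card_fin] at this

/-- The parity of an element of `ZMod 4`; it is `true` for the odd elements. -/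
def parity (z : ZMod 4) : Bool := z == 1 || z == 3

theorem card_mulVec_eq_zero_of_parity {m n : ℕ} {z z' : Fin n → ZMod 4}
    (h : parity ∘ z' ≠ parity ∘ z) :
    (Finset.univ.filter fun A : Matrix (Fin m) (Fin n) (ZMod 4) =>
      A.mulVec (z' - z) = 0).card * 4 ^ m ≤ Fintype.card (Matrix (Fin m) (Fin n) (ZMod 4)) := by
  obtain ⟨i, hi⟩ := Function.ne_iff.1 h
  refine card_mulVec_eq_zero_mul_le (κ := ZMod 4) (z' - z) i id ?_
  have : ∀ a b : ZMod 4, parity a ≠ parity b → Function.Injective fun k => k * (a - b) := by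
    unfold parity Function.Injective
    decide
  exact this _ _ hi

theorem card_mulVec_eq_zero_of_ne {m n : ℕ} {z z' : Fin n → ZMod 4} (h : z' ≠ z) :
    (Finset.univ.filter fun A : Matrix (Fin m) (Fin n) (ZMod 4) =>
      A.mulVec (z' - z) = 0).card * 2 ^ m ≤ Fintype.card (Matrix (Fin m) (Fin n) (ZMod 4)) := by
  obtain ⟨i, hi⟩ := Function.ne_iff.1 h
  refine card_mulVec_eq_zero_mul_le (κ := Bool) (z' - z) i (fun b => if b then 1 else 0) ?_
  have : ∀ a b : ZMod 4, a ≠ b →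
      Function.Injective fun k : Bool => (if k then 1 else 0) * (a - b) := by
    unfold Function.Injective
    decide
  exact this _ _ hi

open Classical in
/-- Averaging over all matrices: some matrix separates the elements of `T`, up to a set of weight
`N₁ / 4 ^ m + N₂ / 2 ^ m`. A difference with an odd coordinate is annihilated with probability
`4 ^ (-m)`; the differences inside a class modulo `2` are annihilated with probability up to
`2 ^ (-m)`, but there are fewer of them. -/
theorem exists_matrix_separating {n : ℕ} (m : ℕ) (T : Finset (Fin n → ZMod 4))
    {w : (Fin n → ZMod 4) → ℝ} (hw : ∀ z, 0 ≤ w z) (hw1 : ∑ z ∈ T, w z ≤ 1) {N₁ N₂ : ℝ}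
    (h₁ : (T.card : ℝ) ≤ N₁)
    (h₂ : ∀ z ∈ T, ((T.filter fun z' => parity ∘ z' = parity ∘ z).card : ℝ) ≤ N₂) :
    ∃ A : Matrix (Fin m) (Fin n) (ZMod 4),
      ∑ z ∈ T, (if ∃ z' ∈ T, z' ≠ z ∧ A.mulVec z' = A.mulVec z then w z else 0) ≤
        N₁ / 4 ^ m + |N₂| / 2 ^ m := by
  set M : ℝ := (Fintype.card (Matrix (Fin m) (Fin n) (ZMod 4)) : ℝ) with hM
  have hM0 : 0 ≤ M := by positivity
  have hN1 : 0 ≤ N₁ := le_trans (by positivity) h₁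
  let K : (Fin n → ZMod 4) → (Fin n → ZMod 4) → ℝ := fun z z' =>
    ((Finset.univ.filter fun A : Matrix (Fin m) (Fin n) (ZMod 4) =>
      A.mulVec (z' - z) = 0).card : ℝ)
  have hK1 : ∀ z z', parity ∘ z' ≠ parity ∘ z → K z z' ≤ M / 4 ^ m := fun z z' h => by
    rw [le_div_iff₀ (by positivity)]
    simp only [K, hM]
    exact_mod_cast card_mulVec_eq_zero_of_parity (m := m) h
  have hK2 : ∀ z z', z' ≠ z → K z z' ≤ M / 2 ^ m := fun z z' h => by
    rw [le_div_iff₀ (by positivity)]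
    simp only [K, hM]
    exact_mod_cast card_mulVec_eq_zero_of_ne (m := m) h
  have hbad : ∀ z ∈ T, ∑ A : Matrix (Fin m) (Fin n) (ZMod 4),
      (if ∃ z' ∈ T, z' ≠ z ∧ A.mulVec z' = A.mulVec z then (1 : ℝ) else 0) ≤
        M * (N₁ / 4 ^ m + |N₂| / 2 ^ m) := by
    intro z hz
    calc _ ≤ ∑ A : Matrix (Fin m) (Fin n) (ZMod 4), ∑ z' ∈ T.filter fun z' => z' ≠ z,
          (if A.mulVec (z' - z) = 0 then (1 : ℝ) else 0) := by
          refine Finset.sum_le_sum fun A _ => ?_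
          have hnn : ∀ z' ∈ T.filter fun z' => z' ≠ z,
              0 ≤ (if A.mulVec (z' - z) = 0 then (1 : ℝ) else 0) := fun z' _ => by
            split_ifs <;> norm_num
          split_ifs with hA
          · obtain ⟨z', hz', hne, he⟩ := hA
            have hmem : z' ∈ T.filter fun z' => z' ≠ z := Finset.mem_filter.2 ⟨hz', hne⟩
            refine le_trans ?_ (Finset.single_le_sum hnn hmem)
            rw [Matrix.mulVec_sub, he, sub_self, if_pos rfl]
          · exact Finset.sum_nonneg hnn
      _ = ∑ z' ∈ T.filter fun z' => z' ≠ z, K z z' := by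
          rw [Finset.sum_comm]
          refine Finset.sum_congr rfl fun z' _ => ?_
          simp [K]
      _ = ∑ z' ∈ (T.filter fun z' => z' ≠ z).filter fun z' => parity ∘ z' = parity ∘ z, K z z' +
          ∑ z' ∈ (T.filter fun z' => z' ≠ z).filter fun z' => ¬ parity ∘ z' = parity ∘ z,
            K z z' := (Finset.sum_filter_add_sum_filter_not _ _ _).symm
      _ ≤ N₂ * (M / 2 ^ m) + N₁ * (M / 4 ^ m) := by
          refine add_le_add ?_ ?_
          · refine (Finset.sum_le_card_nsmul _ _ (M / 2 ^ m) fun z' hz' =>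
              hK2 z z' (Finset.mem_filter.1 (Finset.mem_filter.1 hz').1).2).trans ?_
            rw [nsmul_eq_mul]
            refine mul_le_mul_of_nonneg_right (le_trans ?_ (h₂ z hz)) (by positivity)
            exact_mod_cast Finset.card_le_card
              (Finset.filter_subset_filter _ (Finset.filter_subset _ _))
          · refine (Finset.sum_le_card_nsmul _ _ (M / 4 ^ m) fun z' hz' =>
              hK1 z z' (Finset.mem_filter.1 hz').2).trans ?_
            rw [nsmul_eq_mul]
            refine mul_le_mul_of_nonneg_right (le_trans ?_ h₁) (by positivity)
            exact_mod_cast Finset.card_le_card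
              ((Finset.filter_subset _ _).trans (Finset.filter_subset _ _))
      _ ≤ |N₂| * (M / 2 ^ m) + N₁ * (M / 4 ^ m) :=
          add_le_add_left (mul_le_mul_of_nonneg_right (le_abs_self _) (by positivity)) _
      _ = _ := by ring
  have hsum : ∑ A : Matrix (Fin m) (Fin n) (ZMod 4),
      ∑ z ∈ T, (if ∃ z' ∈ T, z' ≠ z ∧ A.mulVec z' = A.mulVec z then w z else 0) ≤
      ∑ _A : Matrix (Fin m) (Fin n) (ZMod 4), (N₁ / 4 ^ m + |N₂| / 2 ^ m) := by
    rw [Finset.sum_comm, Finset.sum_const, Finset.card_univ, nsmul_eq_mul]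
    calc _ = ∑ z ∈ T, w z * ∑ A : Matrix (Fin m) (Fin n) (ZMod 4),
          (if ∃ z' ∈ T, z' ≠ z ∧ A.mulVec z' = A.mulVec z then (1 : ℝ) else 0) := by
          refine Finset.sum_congr rfl fun z _ => ?_
          rw [Finset.mul_sum]
          refine Finset.sum_congr rfl fun A _ => ?_
          split_ifs <;> simp
      _ ≤ ∑ z ∈ T, w z * (M * (N₁ / 4 ^ m + |N₂| / 2 ^ m)) :=
          Finset.sum_le_sum fun z hz => mul_le_mul_of_nonneg_left (hbad z hz) (hw z)
      _ ≤ _ := by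
          rw [← Finset.sum_mul]
          exact mul_le_of_le_one_left (by positivity) hw1
  obtain ⟨A, -, hA⟩ := Finset.exists_le_of_sum_le Finset.univ_nonempty hsum
  exact ⟨A, hA⟩

variable {Ω : Type*} [MeasurableSpace Ω] {ι : Type*} {𝒳 : ι → Type*}

/-- Linear encoders are encoders. -/
theorem linearlyAchievableRegion_subset_achievableRegion [∀ t, Fintype (𝒳 t)] {𝒴 : Type*}
    (μ : Measure Ω) (X : ℕ → Ω → ∀ t, 𝒳 t) (g : (∀ t, 𝒳 t) → 𝒴) {R : Type*} [Ring R] [Fintype R]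
    (k : ∀ t, 𝒳 t → R) : linearlyAchievableRegion μ X g k ⊆ achievableRegion μ X g := by
  intro r hr ε hε
  obtain ⟨N₀, hN₀⟩ := hr ε hε
  refine ⟨N₀, fun n hn => ?_⟩
  obtain ⟨m, hm, A, ψ, hψ⟩ := hN₀ n hn
  have hemb : ∀ t, Nonempty ((Fin (m t) → R) ↪ Fin ⌊(2 : ℝ) ^ ((n : ℝ) * r t)⌋₊) := fun t => by
    classical
    refine Function.Embedding.nonempty_of_card_le ?_
    rw [Fintype.card_fun, Fintype.card_fin, Fintype.card_fin]
    refine Nat.le_floor ?_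
    exact_mod_cast hm t
  let j : ∀ t, (Fin (m t) → R) ↪ Fin ⌊(2 : ℝ) ^ ((n : ℝ) * r t)⌋₊ := fun t => (hemb t).some
  refine ⟨fun t x => j t ((A t).mulVec fun i => k t (x i)),
    fun b => ψ fun t => Function.invFun (j t) (b t), ?_⟩
  simpa [Function.leftInverse_invFun (j _).injective _] using hψ

variable {μ : Measure Ω} [IsProbabilityMeasure μ] [Fintype ι]

/-- Applying one matrix at all terminals gives the decoder the image of `∑ t, k t (X t)`, from
which it recovers the typical sequence that has this image. -/
theorem exists_decoder [∀ t, Fintype (𝒳 t)] {X : ℕ → Ω → ∀ t, 𝒳 t} {g : (∀ t, 𝒳 t) → ZMod 4}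
    {k : ∀ t, 𝒳 t → ZMod 4} (hk : IsPresentation g k id)
    (hX : ∀ n a, MeasurableSet ((fun ω => g (X n ω)) ⁻¹' {a})) (n m : ℕ)
    (T : Finset (Fin n → ZMod 4)) {N₁ N₂ : ℝ} (h₁ : (T.card : ℝ) ≤ N₁)
    (h₂ : ∀ z ∈ T, ((T.filter fun z' => parity ∘ z' = parity ∘ z).card : ℝ) ≤ N₂) :
    ∃ (A : Matrix (Fin m) (Fin n) (ZMod 4)) (ψ : (ι → Fin m → ZMod 4) → Fin n → ZMod 4),
      μ.real {ω | (fun i : Fin n => g (X i ω)) ≠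
          ψ (fun t => A.mulVec (fun i : Fin n => k t (X i ω t)))} ≤
        μ.real {ω | history (fun n ω => g (X n ω)) n ω ∉ T} +
          (N₁ / 4 ^ m + |N₂| / 2 ^ m) := by
  classical
  set Z : ℕ → Ω → ZMod 4 := fun n ω => g (X n ω) with hZ
  have hw1 : ∑ z ∈ T, histProb μ Z n z ≤ 1 := by
    rw [← real_history_mem hX]
    exact measureReal_le_one
  obtain ⟨A, hA⟩ := exists_matrix_separating m T (histProb_nonneg (μ := μ) Z n) hw1 h₁ h₂
  -- the decoder picks some sequence in `T` with the image that it receives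
  let ψ : (ι → Fin m → ZMod 4) → Fin n → ZMod 4 := fun b =>
    if hb : ∃ z ∈ T, A.mulVec z = ∑ t, b t then hb.choose else 0
  refine ⟨A, ψ, ?_⟩
  have hsum : ∀ ω, ∑ t, A.mulVec (fun i : Fin n => k t (X i ω t)) = A.mulVec (history Z n ω) := by
    intro ω
    rw [← Matrix.mulVec_sum]
    congr 1
    funext i
    rw [Finset.sum_apply]
    exact (hk (X i ω)).symm
  have hsub : {ω | (fun i : Fin n => g (X i ω)) ≠
      ψ (fun t => A.mulVec (fun i : Fin n => k t (X i ω t)))} ⊆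
      {ω | history Z n ω ∉ T} ∪ {ω | history Z n ω ∈ T.filter fun z =>
        ∃ z' ∈ T, z' ≠ z ∧ A.mulVec z' = A.mulVec z} := by
    intro ω hω
    by_contra hcon
    simp only [Set.mem_union, Set.mem_ofPred_eq, Finset.mem_filter, not_or, not_not, not_and]
      at hcon
    obtain ⟨hT, huniq⟩ := hcon
    have huniq := huniq hT
    push Not at huniq
    refine hω ?_
    have hb : ∃ z ∈ T, A.mulVec z = ∑ t, A.mulVec (fun i : Fin n => k t (X i ω t)) :=
      ⟨_, hT, (hsum ω).symm⟩
    simp only [ψ]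
    rw [dif_pos hb]
    by_contra hne
    refine huniq _ hb.choose_spec.1 (fun h => hne h.symm) ?_
    rw [hb.choose_spec.2, hsum]
  refine (measureReal_mono hsub).trans ((measureReal_union_le _ _).trans ?_)
  refine add_le_add_right ?_ _
  rw [real_history_mem hX, Finset.sum_filter]
  exact hA

/-- Linear coding over `ZMod 4` for a sum of sources that forms a refresh chain: the rate has to
exceed the entropy rate of the chain, and twice the entropy rate of the chain given its
reduction modulo `2`. -/
theorem mem_linearlyAchievableRegion [∀ t, Fintype (𝒳 t)] {X : ℕ → Ω → ∀ t, 𝒳 t}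
    {g : (∀ t, 𝒳 t) → ZMod 4} {k : ∀ t, 𝒳 t → ZMod 4} (hk : IsPresentation g k id)
    {c : ℝ} {v : ZMod 4 → ℝ} (h : IsMarkovChain μ (fun n ω => g (X n ω)) (refreshMatrix c v))
    (hc : 0 < c) (hc1 : c ≤ 1) (hv : ∀ x, 0 < v x) (hv1 : ∑ x, v x = 1) {r : ℝ}
    (hr : refreshRate c v < r)
    (hr' : 2 * (refreshRate c v - refreshRate c (pushDist v parity)) < r) :
    (fun _ => r) ∈ linearlyAchievableRegion μ X g k := by
  have hlog : 0 < Real.log 2 := Real.log_pos (by norm_num)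
  set H := refreshRate c v with hH
  set H' := refreshRate c (pushDist v parity) with hH'
  have hH0 : 0 ≤ H := by
    refine div_nonneg (Finset.sum_nonneg fun i _ => ?_) hlog.le
    refine refreshEntropy_nonneg hc.le hc1 (hv i).le ?_
    rw [← hv1]
    exact Finset.single_le_sum (fun j _ => (hv j).le) (Finset.mem_univ i)
  have hr0 : 0 < r := hH0.trans_lt hr
  -- the slack has to pay for the `δ` and `2 δ` of the typical set and to leave `exp (-n δ)`
  set δ : ℝ := min ((r - H) * Real.log 2 / 2) ((r / 2 - (H - H')) * Real.log 2 / 3) with hδdef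
  have hδ1 : δ ≤ (r - H) * Real.log 2 / 2 := min_le_left _ _
  have hδ2 : δ ≤ (r / 2 - (H - H')) * Real.log 2 / 3 := min_le_right _ _
  have hδ : 0 < δ := by
    refine lt_min ?_ ?_
    · exact div_pos (mul_pos (by linarith) hlog) (by norm_num)
    · exact div_pos (mul_pos (by linarith) hlog) (by norm_num)
  obtain ⟨T, hT, hcard⟩ := h.exists_typicalSet hc hc1 hv hv1 (e := parity)
    (by unfold parity Function.Surjective; decide) hδ
  have hcard4 : (Fintype.card (ZMod 4) : ℝ) = 4 := by rw [ZMod.card]; norm_num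
  -- a factor `4 = card (ZMod 4)` comes from the typical set, and `4` or `2` from rounding `m` down
  set B : ℕ → ℝ := fun n => μ.real {ω | history (fun n ω => g (X n ω)) (n + 1) ω ∉ T n} +
    (16 * Real.exp (-(n * δ)) + 8 * Real.exp (-(n * δ))) with hB
  have hexp : Tendsto (fun n : ℕ => Real.exp (-(n * δ))) atTop (𝓝 0) := by
    refine Real.tendsto_exp_neg_atTop_nhds_zero.comp ?_
    exact tendsto_natCast_atTop_atTop.atTop_mul_const hδ
  have hBlim : Tendsto B atTop (𝓝 0) := by
    simpa using hT.add ((hexp.const_mul 16).add (hexp.const_mul 8))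
  intro ε hε
  obtain ⟨N₀, hN₀⟩ := eventually_atTop.1 (hBlim.eventually (gt_mem_nhds hε))
  refine ⟨N₀ + 1, fun N hN => ?_⟩
  obtain ⟨n, rfl⟩ : ∃ n, N = n + 1 := ⟨N - 1, by omega⟩
  set x : ℝ := ((n + 1 : ℕ) : ℝ) * r / 2 with hx
  have hx0 : 0 ≤ x := by positivity
  set m := ⌊x⌋₊ with hm
  have hmx : (m : ℝ) ≤ x := Nat.floor_le hx0
  have hxm : x < m + 1 := Nat.lt_floor_add_one x
  have hnx : n * r / 2 ≤ x := by
    rw [hx]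
    push_cast
    linarith
  have hpow2 : ∀ y : ℝ, (2 : ℝ) ^ y = Real.exp (y * Real.log 2) := fun y => by
    rw [Real.rpow_def_of_pos two_pos, mul_comm]
  have h2m : ((2 : ℝ) ^ m)⁻¹ ≤ 2 * Real.exp (-(n * r / 2 * Real.log 2)) := by
    have : Real.exp (n * r / 2 * Real.log 2) ≤ 2 * 2 ^ m := by
      rw [← pow_succ', ← Real.rpow_natCast, hpow2]
      refine Real.exp_le_exp.2 (mul_le_mul_of_nonneg_right ?_ hlog.le)
      push_cast
      linarith
    rw [Real.exp_neg, ← div_eq_mul_inv, inv_le_comm₀ (by positivity) (by positivity), inv_div,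
      div_le_iff₀ two_pos]
    exact this.trans_eq (mul_comm _ _)
  have h4 : (4 : ℝ) ^ m = 2 ^ m * 2 ^ m := by rw [← mul_pow]; norm_num
  have h4m : ((4 : ℝ) ^ m)⁻¹ ≤ 4 * Real.exp (-(n * r * Real.log 2)) := by
    rw [h4, mul_inv]
    refine (mul_le_mul h2m h2m (by positivity) (by positivity)).trans (le_of_eq ?_)
    rw [mul_mul_mul_comm, ← Real.exp_add]
    congr 1
    · norm_num
    · congr 1
      ring
  obtain ⟨A, ψ, hψ⟩ := exists_decoder (μ := μ) hk h.measurable (n + 1) m (T n) (hcard n).1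
    (hcard n).2
  refine ⟨fun _ => m, fun _ => ?_, fun _ => A, ψ, ?_⟩
  · rw [hcard4, h4, ← pow_add, ← Real.rpow_natCast]
    refine Real.rpow_le_rpow_of_exponent_le (by norm_num) ?_
    push_cast at hmx hx ⊢
    linarith
  · refine (hψ.trans ?_).trans_lt (hN₀ n (by omega))
    rw [hB]
    refine add_le_add_right (add_le_add ?_ ?_) _
    · rw [hcard4, div_eq_mul_inv]
      refine (mul_le_mul_of_nonneg_left h4m (by positivity)).trans ?_
      rw [mul_mul_mul_comm, ← Real.exp_add]
      refine mul_le_mul (by norm_num) (Real.exp_le_exp.2 ?_) (by positivity) (by norm_num)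
      have := mul_le_mul_of_nonneg_left hδ1 (Nat.cast_nonneg (α := ℝ) n)
      linarith
    · rw [hcard4, div_eq_mul_inv, abs_of_nonneg (by positivity)]
      refine (mul_le_mul_of_nonneg_left h2m (by positivity)).trans ?_
      rw [mul_mul_mul_comm, ← Real.exp_add]
      refine mul_le_mul (by norm_num) (Real.exp_le_exp.2 ?_) (by positivity) (by norm_num)
      have := mul_le_mul_of_nonneg_left hδ2 (Nat.cast_nonneg (α := ℝ) n)
      linarith

end Coding

/-! ### The rate regions of sums of sources -/

section RingRegion

variable {σ κ : Type*} [Fintype σ]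

open Classical in
/-- The stochastic complement of a class of states of a refresh chain is again a refresh chain,
with the conditional distribution of the class as fresh distribution. -/
theorem stochComplement_refreshMatrix {c : ℝ} (hc : c ≠ 0) {v : σ → ℝ} (h1 : ∑ x, v x = 1)
    (p : σ → Prop) (hp : ∑ x : {x // p x}, v x ≠ 0) (i j : {x // p x}) :
    stochComplement (refreshMatrix c v) p i j =
      c * (v j / ∑ x : {x // p x}, v x) + (1 - c) * (if i = j then 1 else 0) := by
  set s := ∑ x : {x // p x}, v x with hs
  have ht : ∑ x : {x // ¬ p x}, v x = 1 - s := by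
    rw [← h1, ← Fintype.sum_subtype_add_sum_subtype p v, hs]
    ring
  -- `1 - P` is `c` times a rank one perturbation of the identity on the complement of the class
  let N : Matrix {x // ¬ p x} {x // ¬ p x} ℝ :=
    Matrix.of fun k l => ((if k = l then 1 else 0) + v l / s) / c
  have hinv : (1 - (refreshMatrix c v).toBlock (fun x => ¬ p x) (fun x => ¬ p x))⁻¹ = N := by
    refine Matrix.inv_eq_right_inv ?_
    ext k l
    have e : ∀ m : {x // ¬ p x},
        (1 - (refreshMatrix c v).toBlock (fun x => ¬ p x) (fun x => ¬ p x)) k m * N m l =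
        (if k = m then (if m = l then 1 else 0) + v l / s else 0) -
          ((if m = l then v l else 0) + v m * (v l / s)) := by
      intro m
      have e0 : (1 - (refreshMatrix c v).toBlock (fun x => ¬ p x) (fun x => ¬ p x)) k m =
          c * ((if k = m then 1 else 0) - v m) := by
        simp only [Matrix.sub_apply, Matrix.one_apply, Matrix.toBlock_apply, refreshMatrix_apply,
          Subtype.ext_iff]
        ring
      rw [e0]
      simp only [N, Matrix.of_apply]
      generalize v l / s = y
      field_simp
      split_ifs with h₁ h₂ h₂ <;> (try rw [h₂]) <;> ring
    rw [Matrix.mul_apply]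
    simp_rw [e, Finset.sum_sub_distrib, Finset.sum_add_distrib, ← Finset.sum_mul, ht]
    simp only [Finset.sum_ite_eq, Finset.sum_ite_eq', Finset.mem_univ, if_true, Matrix.one_apply]
    field_simp
    ring
  have hne : ∀ (a : {x // p x}) (b : {x // ¬ p x}), (a : σ) ≠ b := fun a b h =>
    b.2 (h ▸ a.2)
  have hN : ∀ l, ∑ k : {x // ¬ p x}, c * v k * N k l = v l / s := by
    intro l
    have e : ∀ k : {x // ¬ p x}, c * v k * N k l =
        (if k = l then v l else 0) + v k * (v l / s) := by
      intro k
      simp only [N, Matrix.of_apply]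
      generalize v l / s = y
      field_simp
      split_ifs with h₁
      · rw [h₁]; ring
      · ring
    simp_rw [e, Finset.sum_add_distrib, ← Finset.sum_mul, ht]
    simp only [Finset.sum_ite_eq', Finset.mem_univ, if_true]
    field_simp
    ring
  rw [stochComplement, hinv, Matrix.add_apply, Matrix.mul_apply]
  simp_rw [Matrix.mul_apply, Matrix.toBlock_apply, refreshMatrix_apply, if_neg (hne _ _),
    if_neg (hne _ _).symm, mul_zero, add_zero, hN, ← Finset.sum_mul, ← Finset.sum_div, ht,
    Subtype.ext_iff]
  field_simp
  ring

/-- The chain watched inside the classes has at least the entropy rate of the chain given the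
sequence of classes. -/
theorem refreshRate_sub_le_matrixEntropy [DecidableEq σ] [Fintype κ] [DecidableEq κ] {c : ℝ}
    (hc : 0 < c) (hc1 : c ≤ 1) {v : σ → ℝ} (hv : ∀ x, 0 < v x) (h1 : ∑ x, v x = 1) (e : σ → κ) :
    refreshRate c v - refreshRate c (pushDist v e) ≤
      matrixEntropy (blockStochComplement (refreshMatrix c v) e) v := by
  obtain rfl : ‹DecidableEq σ› = fun a b => Classical.propDecidable (a = b) :=
    Subsingleton.elim _ _
  classical
  set w := pushDist v e with hw
  set q : σ → ℝ := fun j => v j / w (e j) with hq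
  have hw0 : ∀ x, 0 < w (e x) := pushDist_pos hv e
  have hw1 : ∀ x, w (e x) ≤ 1 := fun x => pushDist_le_one (fun x => (hv x).le) h1 e _
  have hvw : ∀ x, v x ≤ w (e x) := fun x =>
    Finset.single_le_sum (fun y _ => (hv y).le) (by simp)
  have hvq : ∀ x, v x = q x * w (e x) := fun x => (div_mul_cancel₀ _ (hw0 x).ne').symm
  have hblock : ∀ i j, blockStochComplement (refreshMatrix c v) e i j =
      if e j = e i then refreshMatrix c q i j else 0 := by
    intro i j
    rw [blockStochComplement, Matrix.of_apply]
    split_ifs with h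
    · have hsum : ∀ _ : Fintype {x // e x = e i}, ∑ x : {x // e x = e i}, v x = w (e i) := by
        intro _
        rw [hw, pushDist, Finset.sum_subtype (p := fun x => e x = e i)]
        simp
      rw [stochComplement_refreshMatrix hc.ne' h1 _ (by rw [hsum _]; exact (hw0 i).ne'), hsum _,
        refreshMatrix_apply]
      simp only [Subtype.ext_iff, hq, h]
    · rfl
  have hS : matrixEntropy (blockStochComplement (refreshMatrix c v) e) v =
      (∑ j, w (e j) * refreshEntropy c (q j)) / Real.log 2 := by
    unfold matrixEntropy
    simp_rw [hblock, ← Finset.sum_div, ← mul_div_assoc, ← Finset.sum_div, Finset.mul_sum]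
    rw [Finset.sum_comm]
    congr 1
    refine Finset.sum_congr rfl fun j _ => ?_
    have e1 : ∀ i, v i * negMulLog (if e j = e i then refreshMatrix c q i j else 0) =
        if e i = e j then v i * negMulLog (refreshMatrix c q i j) else 0 := by
      intro i
      by_cases h : e i = e j
      · rw [if_pos h, if_pos h.symm]
      · rw [if_neg h, if_neg (Ne.symm h)]
        simp
    simp_rw [e1]
    rw [← Finset.sum_filter, sum_mul_negMulLog_refreshMatrix _ _ (by simp : j ∈ _)]
    have e2 : ∑ i with e i = e j, v i = w (e j) := rfl
    rw [e2, refreshEntropy, hvq j]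
    ring
  rw [hS, refreshRate, refreshRate, ← sub_div]
  refine div_le_div_of_nonneg_right ?_ (Real.log_nonneg (by norm_num))
  rw [sub_le_iff_le_add]
  have hlast : ∑ y, refreshEntropy c (w y) = ∑ j, q j * refreshEntropy c (w (e j)) := by
    rw [← Finset.sum_fiberwise Finset.univ e]
    refine Finset.sum_congr rfl fun y _ => ?_
    by_cases hy : ∃ x, e x = y
    · obtain ⟨x, rfl⟩ := hy
      have e3 : ∑ j with e j = e x, q j * refreshEntropy c (w (e j)) =
          ∑ j with e j = e x, v j * (refreshEntropy c (w (e x)) / w (e x)) :=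
        Finset.sum_congr rfl fun j hj => by
          rw [hq, (Finset.mem_filter.1 hj).2]
          simp only [(Finset.mem_filter.1 hj).2]
          ring
      rw [e3, ← Finset.sum_mul]
      change _ = w (e x) * _
      rw [mul_div_cancel₀ _ (hw0 x).ne']
    · push Not at hy
      have e4 : (Finset.univ.filter fun x => e x = y) = ∅ :=
        Finset.filter_eq_empty_iff.2 fun x _ => hy x
      rw [hw, pushDist, e4]
      simp
  rw [hlast, ← Finset.sum_add_distrib]
  refine Finset.sum_le_sum fun j _ => ?_
  have := refreshEntropy_mul_le hc hc1 (p := q j) (s := w (e j))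
    (div_nonneg (hv j).le (hw0 j).le) (div_le_one_of_le₀ (hvw j) (hw0 j).le) (hw0 j) (hw1 j)
  rwa [← hvq] at this

/-- The entropy rate of the lumping by `e` of the stationary refresh chain with fresh
distribution `u`, in bits. The choice of instances for the finite type `τ` is immaterial. -/
def lumpedRate {τ : Type*} [Finite τ] (c : ℝ) (u : σ → ℝ) (e : σ → τ) : ℝ :=
  letI := Fintype.ofFinite τ
  letI := Classical.decEq τ
  refreshRate c (pushDist u e)

theorem lumpedRate_eq {τ : Type*} [Fintype τ] [DecidableEq τ] (c : ℝ) (u : σ → ℝ) (e : σ → τ) :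
    lumpedRate c u e = refreshRate c (pushDist u e) := by
  unfold lumpedRate
  congr!

theorem lumpedRate_mono {c : ℝ} (hc : 0 ≤ c) (hc1 : c ≤ 1) {u : σ → ℝ}
    (hu : ∀ x, 0 ≤ u x) (h1 : ∑ x, u x = 1) {τ τ' : Type*} [Finite τ] [Finite τ'] (e : σ → τ)
    (f : σ → τ') (h : ∀ x y, e x = e y → f x = f y) : lumpedRate c u f ≤ lumpedRate c u e := by
  classical
  cases nonempty_fintype τ
  cases nonempty_fintype τ'
  rw [lumpedRate_eq, lumpedRate_eq]
  exact refreshRate_pushDist_mono hc hc1 hu h1 e f h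

variable {Ω : Type*} [MeasurableSpace Ω] {μ : Measure Ω} [IsProbabilityMeasure μ]
  {ι : Type*} [Fintype ι] {𝒳 : ι → Type*} [∀ t, Fintype (𝒳 t)]

/-- The state `∑ t, k t (x t)` of the sum process when the sources are in state `x`. -/
def sumState {R : Type*} [Ring R] (k : ∀ t, 𝒳 t → R) (x : ∀ t, 𝒳 t) : SumState k :=
  ⟨∑ t, k t (x t), x, rfl⟩

/-- When the sources form a refresh chain, the minimum in the definition of `ringRegion` is always
attained by the second expression, and that is a difference of entropy rates of lumped chains. -/
theorem mem_ringRegion_iff [Fintype (∀ t, 𝒳 t)] [DecidableEq (∀ t, 𝒳 t)]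
    {X : ℕ → Ω → ∀ t, 𝒳 t} {c : ℝ} {u : (∀ t, 𝒳 t) → ℝ}
    (h : IsMarkovChain μ X (refreshMatrix c u)) (hc : 0 < c) (hc1 : c ≤ 1)
    (hu : ∀ x, 0 < u x) (h1 : ∑ x, u x = 1) {R : Type*} [Ring R] [Fintype R]
    (k : ∀ t, 𝒳 t → R) (ρ : ι → ℝ) :
    ρ ∈ ringRegion μ X k ↔ ∃ r : ℝ, (ρ = fun _ => r) ∧ ∀ I : Ideal R, I ≠ ⊥ →
      Real.log (Fintype.card R) / Real.log (Nat.card I) *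
        (lumpedRate c u (sumState k) -
          lumpedRate c u fun x => sumCoset k I (sumState k x)) < r := by
  let _ : DecidableEq (SumState k) := Classical.decEq _
  have hu' : ∀ x, 0 ≤ u x := fun x => (hu x).le
  set v := pushDist u (sumState k) with hv
  have hv0 : ∀ z, 0 < v z := by
    rintro ⟨_, x, rfl⟩
    exact pushDist_pos hu (sumState k) x
  have hv1 : ∀ _ : Fintype (SumState k), ∑ z, v z = 1 := by
    intro _
    rw [hv, sum_pushDist, h1]
  have hZ : ∀ _ : Fintype (SumState k), IsMarkovChain μ (sumProcess k X) (refreshMatrix c v) :=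
    fun _ => h.lump_refreshMatrix hc.le hc1 hu' h1 (sumState k)
  have hlim : ∀ I : Ideal R, Tendsto (fun m : ℕ => condEntropy μ
      (fun ω => sumCoset k I (sumProcess k X (m + 1) ω))
      (fun ω => sumCoset k I (sumProcess k X m ω))) atTop
      (𝓝 (lumpedRate c u fun x => sumCoset k I (sumState k x))) := fun I => by
    let _ := Fintype.ofFinite (R ⧸ Submodule.toAddSubgroup I)
    let _ := Classical.decEq (R ⧸ Submodule.toAddSubgroup I)
    rw [lumpedRate_eq]
    exact (h.lump_refreshMatrix hc.le hc1 hu' h1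
      fun x => sumCoset k I (sumState k x)).tendsto_condEntropy hc hc1 (by rw [sum_pushDist, h1])
  have hmin : ∀ (_ : Fintype (SumState k)) (I : Ideal R),
      min (matrixEntropy (blockStochComplement (refreshMatrix c v) (sumCoset k I)) v)
        (matrixEntropy (refreshMatrix c v) v -
          lumpedRate c u fun x => sumCoset k I (sumState k x)) =
      lumpedRate c u (sumState k) - lumpedRate c u fun x => sumCoset k I (sumState k x) := by
    intro _ I
    let _ := Fintype.ofFinite (R ⧸ Submodule.toAddSubgroup I)
    let _ := Classical.decEq (R ⧸ Submodule.toAddSubgroup I)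
    have := refreshRate_sub_le_matrixEntropy hc hc1 hv0 (hv1 _) (sumCoset k I)
    rw [hv, ← pushDist_comp] at this
    rw [matrixEntropy_refreshMatrix (hv1 _), lumpedRate_eq, lumpedRate_eq, min_eq_right]
    exact this
  -- the quantifier over instances makes the statement apply to the one chosen in `ringRegion`
  have key : ∀ (_ : Fintype (SumState k)) (r : ℝ),
      (∃ (P : Matrix (SumState k) (SumState k) ℝ) (π : SumState k → ℝ),
        IsMarkovChain μ (sumProcess k X) P ∧ IrreducibleMatrix P ∧ IsInvariantDistribution P π ∧
        ∀ I : Ideal R, I ≠ ⊥ → ∃ ℓ : ℝ,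
          Tendsto (fun m : ℕ => condEntropy μ
            (fun ω => sumCoset k I (sumProcess k X (m + 1) ω))
            (fun ω => sumCoset k I (sumProcess k X m ω))) atTop (𝓝 ℓ) ∧
          Real.log (Fintype.card R) / Real.log (Nat.card I) *
            min (matrixEntropy (blockStochComplement P (sumCoset k I)) π)
              (matrixEntropy P π - ℓ) < r) ↔
      ∀ I : Ideal R, I ≠ ⊥ → Real.log (Fintype.card R) / Real.log (Nat.card I) *
        (lumpedRate c u (sumState k) -
          lumpedRate c u fun x => sumCoset k I (sumState k x)) < r := by
    intro _ r
    constructor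
    · rintro ⟨P, π, hP, -, hπ, hI⟩ I hne
      obtain rfl : P = refreshMatrix c v := hP.eq_of_pos (hZ _) (refreshMatrix_pos hc hc1 hv0)
      obtain rfl : π = v := hπ.eq_of_refreshMatrix hc.ne'
      obtain ⟨l, hl, hlt⟩ := hI I hne
      rwa [tendsto_nhds_unique hl (hlim I), hmin _] at hlt
    · intro hI
      refine ⟨refreshMatrix c v, v, hZ _, irreducibleMatrix_refreshMatrix hc hc1 hv0,
        isInvariantDistribution_refreshMatrix (fun z => (hv0 z).le) (hv1 _), fun I hne =>
        ⟨_, hlim I, ?_⟩⟩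
      rw [hmin _]
      exact hI I hne
  constructor
  · rintro ⟨r, hr, H⟩
    exact ⟨r, hr, (key _ r).1 H⟩
  · rintro ⟨r, hr, H⟩
    exact ⟨r, hr, (key _ r).2 H⟩

end RingRegion

/-! ### Numerical bounds for the entropy rates of the example -/

section Numerics

/-- The hypothesis says that `j / k` is an upper bound for `-log₂ x`. -/
theorem negMulLog_le_of_pow {x : ℝ} (hx : 0 < x) (k j : ℕ) (hk : 0 < k)
    (h : 1 ≤ x ^ k * 2 ^ j) : negMulLog x ≤ x * (j / k) * Real.log 2 := by
  have h1 := Real.log_nonneg h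
  rw [Real.log_mul (by positivity) (by positivity), Real.log_pow, Real.log_pow] at h1
  have hk' : (0 : ℝ) < k := by exact_mod_cast hk
  have : -Real.log x ≤ j / k * Real.log 2 := by
    rw [div_mul_eq_mul_div, le_div_iff₀ hk']
    linarith
  have := mul_le_mul_of_nonneg_left this hx.le
  rw [negMulLog]
  linarith

/-- The hypothesis says that `j / k` is a lower bound for `-log₂ x`. -/
theorem le_negMulLog_of_pow {x : ℝ} (hx : 0 < x) (k j : ℕ) (hk : 0 < k)
    (h : x ^ k * 2 ^ j ≤ 1) : x * (j / k) * Real.log 2 ≤ negMulLog x := by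
  have h1 := Real.log_nonpos (by positivity) h
  rw [Real.log_mul (by positivity) (by positivity), Real.log_pow, Real.log_pow] at h1
  have hk' : (0 : ℝ) < k := by exact_mod_cast hk
  have : j / k * Real.log 2 ≤ -Real.log x := by
    rw [div_mul_eq_mul_div, div_le_iff₀ hk']
    linarith
  have := mul_le_mul_of_nonneg_left this hx.le
  rw [negMulLog]
  linarith

theorem refreshEntropy_one_div_fortyfive_le :
    refreshEntropy (87 / 100) (1 / 45) ≤ 1169 / 10000 * Real.log 2 := by
  have h1 := negMulLog_le_of_pow (x := 56 / 375) (by norm_num) 4 11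
    (by norm_num) (by norm_num)
  have h2 := negMulLog_le_of_pow (x := 29 / 1500) (by norm_num) 10 57
    (by norm_num) (by norm_num)
  have h3 : 0 < Real.log 2 := Real.log_pos (by norm_num)
  norm_num [refreshEntropy] at h1 h2 ⊢
  linarith

theorem refreshEntropy_fourteen_div_fifteen_le :
    refreshEntropy (87 / 100) (14 / 15) ≤ 483 / 5000 * Real.log 2 := by
  have h1 := negMulLog_le_of_pow (x := 471 / 500) (by norm_num) 11 1
    (by norm_num) (by norm_num)
  have h2 := negMulLog_le_of_pow (x := 203 / 250) (by norm_num) 13 4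
    (by norm_num) (by norm_num)
  have h3 : 0 < Real.log 2 := Real.log_pos (by norm_num)
  norm_num [refreshEntropy] at h1 h2 ⊢
  linarith

theorem le_refreshEntropy_one_div_fortyfive :
    583 / 5000 * Real.log 2 ≤ refreshEntropy (87 / 100) (1 / 45) := by
  have h1 := le_negMulLog_of_pow (x := 56 / 375) (by norm_num) 19 52
    (by norm_num) (by norm_num)
  have h2 := le_negMulLog_of_pow (x := 29 / 1500) (by norm_num) 13 74
    (by norm_num) (by norm_num)
  have h3 : 0 < Real.log 2 := Real.log_pos (by norm_num)
  norm_num [refreshEntropy] at h1 h2 ⊢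
  linarith

theorem le_refreshEntropy_fourteen_div_fifteen :
    179 / 2000 * Real.log 2 ≤ refreshEntropy (87 / 100) (14 / 15) := by
  have h1 := le_negMulLog_of_pow (x := 471 / 500) (by norm_num) 12 1
    (by norm_num) (by norm_num)
  have h2 := le_negMulLog_of_pow (x := 203 / 250) (by norm_num) 10 3
    (by norm_num) (by norm_num)
  have h3 : 0 < Real.log 2 := Real.log_pos (by norm_num)
  norm_num [refreshEntropy] at h1 h2 ⊢
  linarith

theorem le_refreshEntropy_one_div_ninety :
    683 / 10000 * Real.log 2 ≤ refreshEntropy (87 / 100) (1 / 90) := by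
  have h1 := le_negMulLog_of_pow (x := 419 / 3000) (by norm_num) 6 17
    (by norm_num) (by norm_num)
  have h2 := le_negMulLog_of_pow (x := 29 / 3000) (by norm_num) 13 87
    (by norm_num) (by norm_num)
  have h3 : 0 < Real.log 2 := Real.log_pos (by norm_num)
  norm_num [refreshEntropy] at h1 h2 ⊢
  linarith

theorem le_refreshEntropy_two_div_fortyfive :
    77 / 400 * Real.log 2 ≤ refreshEntropy (87 / 100) (2 / 45) := by
  have h1 := le_negMulLog_of_pow (x := 253 / 1500) (by norm_num) 16 41
    (by norm_num) (by norm_num)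
  have h2 := le_negMulLog_of_pow (x := 29 / 750) (by norm_num) 13 61
    (by norm_num) (by norm_num)
  have h3 : 0 < Real.log 2 := Real.log_pos (by norm_num)
  norm_num [refreshEntropy] at h1 h2 ⊢
  linarith

theorem le_refreshEntropy_fortythree_div_fortyfive :
    607 / 10000 * Real.log 2 ≤ refreshEntropy (87 / 100) (43 / 45) := by
  have h1 := le_negMulLog_of_pow (x := 721 / 750) (by norm_num) 18 1
    (by norm_num) (by norm_num)
  have h2 := le_negMulLog_of_pow (x := 1247 / 1500) (by norm_num) 19 5
    (by norm_num) (by norm_num)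
  have h3 : 0 < Real.log 2 := Real.log_pos (by norm_num)
  norm_num [refreshEntropy] at h1 h2 ⊢
  linarith

theorem le_refreshEntropy_seven_div_fifteen :
    1263 / 2500 * Real.log 2 ≤ refreshEntropy (87 / 100) (7 / 15) := by
  have h1 := le_negMulLog_of_pow (x := 67 / 125) (by norm_num) 19 17
    (by norm_num) (by norm_num)
  have h2 := le_negMulLog_of_pow (x := 203 / 500) (by norm_num) 10 13
    (by norm_num) (by norm_num)
  have h3 : 0 < Real.log 2 := Real.log_pos (by norm_num)
  norm_num [refreshEntropy] at h1 h2 ⊢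
  linarith

theorem le_refreshEntropy_eight_div_fifteen :
    4769 / 10000 * Real.log 2 ≤ refreshEntropy (87 / 100) (8 / 15) := by
  have h1 := le_negMulLog_of_pow (x := 297 / 500) (by norm_num) 4 3
    (by norm_num) (by norm_num)
  have h2 := le_negMulLog_of_pow (x := 58 / 125) (by norm_num) 19 21
    (by norm_num) (by norm_num)
  have h3 : 0 < Real.log 2 := Real.log_pos (by norm_num)
  norm_num [refreshEntropy] at h1 h2 ⊢
  linarith

theorem exampleMatrix_eq : exampleMatrix = refreshMatrix (87 / 100) exampleDist := by
  ext x y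
  simp only [exampleMatrix, refreshMatrix_apply, Matrix.of_apply]
  norm_num

theorem exampleDist_pos (x : Fin 3 → Fin 2) : 0 < exampleDist x := by
  unfold exampleDist
  split_ifs <;> norm_num

theorem univ_states : (Finset.univ : Finset (Fin 3 → Fin 2)) =
    {![0, 0, 0], ![1, 0, 1], ![1, 0, 0], ![0, 1, 1], ![0, 1, 0], ![1, 1, 1], ![1, 1, 0],
      ![0, 0, 1]} := by
  decide

/-- Sums over the eight states, in an order that groups the fibres of `exampleFun`. -/
theorem sum_states {M : Type*} [AddCommMonoid M] (f : (Fin 3 → Fin 2) → M) :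
    ∑ x, f x = f ![0, 0, 0] + (f ![1, 0, 1] + (f ![1, 0, 0] + (f ![0, 1, 1] + (f ![0, 1, 0] +
      (f ![1, 1, 1] + (f ![1, 1, 0] + f ![0, 0, 1])))))) := by
  rw [univ_states]
  repeat rw [Finset.sum_insert (by decide)]
  rw [Finset.sum_singleton]

theorem exampleDist_values :
    exampleDist ![0, 0, 0] = 1 / 90 ∧ exampleDist ![1, 0, 1] = 1 / 90 ∧
    exampleDist ![1, 0, 0] = 1 / 90 ∧ exampleDist ![0, 1, 1] = 1 / 90 ∧
    exampleDist ![0, 1, 0] = 1 / 90 ∧ exampleDist ![1, 1, 1] = 1 / 90 ∧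
    exampleDist ![1, 1, 0] = 7 / 15 ∧ exampleDist ![0, 0, 1] = 7 / 15 := by
  unfold exampleDist
  refine ⟨if_neg (by decide), if_neg (by decide), if_neg (by decide), if_neg (by decide),
    if_neg (by decide), if_neg (by decide), if_pos (by decide), if_pos (by decide)⟩

theorem exampleFun_values :
    exampleFun ![0, 0, 0] = 0 ∧ exampleFun ![1, 0, 1] = 0 ∧
    exampleFun ![1, 0, 0] = 1 ∧ exampleFun ![0, 1, 1] = 1 ∧
    exampleFun ![0, 1, 0] = 2 ∧ exampleFun ![1, 1, 1] = 2 ∧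
    exampleFun ![1, 1, 0] = 3 ∧ exampleFun ![0, 0, 1] = 3 := by
  unfold exampleFun
  decide

theorem sum_exampleDist : ∑ x, exampleDist x = 1 := by
  obtain ⟨h1, h2, h3, h4, h5, h6, h7, h8⟩ := exampleDist_values
  rw [sum_states, h1, h2, h3, h4, h5, h6, h7, h8]
  norm_num

theorem pushDist_states {τ : Type*} [DecidableEq τ] (e : (Fin 3 → Fin 2) → τ) (y : τ) :
    pushDist exampleDist e y =
      (if e ![0, 0, 0] = y then 1 / 90 else 0) + ((if e ![1, 0, 1] = y then 1 / 90 else 0) +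
      ((if e ![1, 0, 0] = y then 1 / 90 else 0) + ((if e ![0, 1, 1] = y then 1 / 90 else 0) +
      ((if e ![0, 1, 0] = y then 1 / 90 else 0) + ((if e ![1, 1, 1] = y then 1 / 90 else 0) +
      ((if e ![1, 1, 0] = y then 7 / 15 else 0) +
        (if e ![0, 0, 1] = y then 7 / 15 else 0))))))) := by
  obtain ⟨h1, h2, h3, h4, h5, h6, h7, h8⟩ := exampleDist_values
  rw [pushDist, Finset.sum_filter, sum_states, h1, h2, h3, h4, h5, h6, h7, h8]

theorem pushDist_exampleFun : pushDist exampleDist exampleFun =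
    fun z => if z = 3 then 14 / 15 else 1 / 45 := by
  obtain ⟨h1, h2, h3, h4, h5, h6, h7, h8⟩ := exampleFun_values
  have d : (0 : ZMod 4) ≠ 1 ∧ (0 : ZMod 4) ≠ 2 ∧ (0 : ZMod 4) ≠ 3 ∧ (1 : ZMod 4) ≠ 2 ∧
    (1 : ZMod 4) ≠ 3 ∧ (2 : ZMod 4) ≠ 3 := by decide
  obtain ⟨d1, d2, d3, d4, d5, d6⟩ := d
  funext z
  rw [pushDist_states, h1, h2, h3, h4, h5, h6, h7, h8]
  have hz : ∀ z : ZMod 4, z = 0 ∨ z = 1 ∨ z = 2 ∨ z = 3 := by decide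
  rcases hz z with rfl | rfl | rfl | rfl
  · simp [d1.symm, d2.symm, d3, d3.symm]; norm_num
  · simp [d1, d4.symm, d5, d5.symm]; norm_num
  · simp [d2, d4, d6, d6.symm]; norm_num
  · simp [d3, d5, d6]; norm_num

theorem sum_zmod_four {M : Type*} [AddCommMonoid M] (f : ZMod 4 → M) :
    ∑ z, f z = f 0 + (f 1 + (f 2 + f 3)) := by
  have : (Finset.univ : Finset (ZMod 4)) = {0, 1, 2, 3} := by decide
  rw [this]
  repeat rw [Finset.sum_insert (by decide)]
  rw [Finset.sum_singleton]

theorem refreshRate_exampleFun_lt :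
    refreshRate (87 / 100) (pushDist exampleDist exampleFun) < 9 / 20 := by
  have h0 : 0 < Real.log 2 := Real.log_pos (by norm_num)
  have d : (0 : ZMod 4) ≠ 3 ∧ (1 : ZMod 4) ≠ 3 ∧ (2 : ZMod 4) ≠ 3 := by decide
  rw [refreshRate, sum_zmod_four, pushDist_exampleFun, div_lt_iff₀ h0]
  simp only [d, if_true, if_false]
  linarith [refreshEntropy_one_div_fortyfive_le, refreshEntropy_fourteen_div_fifteen_le]

theorem refreshRate_parity_lt :
    2 * (refreshRate (87 / 100) (pushDist exampleDist exampleFun) -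
      refreshRate (87 / 100) (pushDist (pushDist exampleDist exampleFun) parity)) < 9 / 20 := by
  have h0 : 0 < Real.log 2 := Real.log_pos (by norm_num)
  have d : (0 : ZMod 4) ≠ 3 ∧ (1 : ZMod 4) ≠ 3 ∧ (2 : ZMod 4) ≠ 3 := by decide
  have p : parity 0 = false ∧ parity 1 = true ∧ parity 2 = false ∧ parity 3 = true := by decide
  have e1 : pushDist (pushDist exampleDist exampleFun) parity true = 43 / 45 := by
    rw [pushDist, Finset.sum_filter, sum_zmod_four, pushDist_exampleFun]
    simp [p, d]
    norm_num
  have e2 : pushDist (pushDist exampleDist exampleFun) parity false = 2 / 45 := by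
    rw [pushDist, Finset.sum_filter, sum_zmod_four, pushDist_exampleFun]
    simp [p, d]
    norm_num
  have e3 : refreshRate (87 / 100) (pushDist exampleDist exampleFun) =
      (3 * refreshEntropy (87 / 100) (1 / 45) + refreshEntropy (87 / 100) (14 / 15)) /
        Real.log 2 := by
    rw [refreshRate, sum_zmod_four, pushDist_exampleFun]
    simp only [d, if_true, if_false]
    ring
  rw [e3, refreshRate, Fintype.sum_bool, e1, e2, ← sub_div, ← mul_div_assoc, div_lt_iff₀ h0]
  linarith [refreshEntropy_one_div_fortyfive_le, refreshEntropy_fourteen_div_fifteen_le,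
    le_refreshEntropy_two_div_fortyfive, le_refreshEntropy_fortythree_div_fortyfive]

theorem lt_refreshRate_exampleDist :
    3 * (9 / 20) < refreshRate (87 / 100) exampleDist := by
  have h0 : 0 < Real.log 2 := Real.log_pos (by norm_num)
  obtain ⟨h1, h2, h3, h4, h5, h6, h7, h8⟩ := exampleDist_values
  rw [refreshRate, sum_states, h1, h2, h3, h4, h5, h6, h7, h8, lt_div_iff₀ h0]
  linarith [le_refreshEntropy_seven_div_fifteen, le_refreshEntropy_one_div_ninety]

/-- Lumping all states except `(0, 0, 1)` into one. -/
theorem lt_refreshRate_separate :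
    9 / 20 < refreshRate (87 / 100) (pushDist exampleDist fun x => decide (x = ![0, 0, 1])) := by
  have h0 : 0 < Real.log 2 := Real.log_pos (by norm_num)
  have e1 : pushDist exampleDist (fun x => decide (x = ![0, 0, 1])) true = 7 / 15 := by
    rw [pushDist_states]
    simp
  have e2 : pushDist exampleDist (fun x => decide (x = ![0, 0, 1])) false = 8 / 15 := by
    rw [pushDist_states]
    simp
    norm_num
  rw [refreshRate, Fintype.sum_bool, e1, e2, lt_div_iff₀ h0]
  linarith [le_refreshEntropy_seven_div_fifteen, le_refreshEntropy_eight_div_fifteen]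

/-- Lumping the states along the fibres of `exampleFun`, with the fibre of `1` split. -/
theorem lt_refreshRate_split :
    9 / 20 < refreshRate (87 / 100)
      (pushDist exampleDist fun x => (exampleFun x, decide (x = ![0, 1, 1]))) := by
  have h0 : 0 < Real.log 2 := Real.log_pos (by norm_num)
  obtain ⟨h1, h2, h3, h4, h5, h6, h7, h8⟩ := exampleFun_values
  have d : (0 : ZMod 4) ≠ 1 ∧ (0 : ZMod 4) ≠ 2 ∧ (0 : ZMod 4) ≠ 3 ∧ (1 : ZMod 4) ≠ 2 ∧
    (1 : ZMod 4) ≠ 3 ∧ (2 : ZMod 4) ≠ 3 := by decide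
  obtain ⟨d1, d2, d3, d4, d5, d6⟩ := d
  rw [refreshRate, Fintype.sum_prod_type, sum_zmod_four]
  simp only [Fintype.sum_bool, pushDist_states, h1, h2, h3, h4, h5, h6, h7, h8, Prod.mk.injEq]
  simp [d1, d2, d3, d4, d5, d6, d1.symm, d2.symm, d3.symm, d4.symm, d5.symm, d6.symm]
  rw [lt_div_iff₀ h0]
  have := le_refreshEntropy_one_div_fortyfive
  have := le_refreshEntropy_fourteen_div_fifteen
  have := le_refreshEntropy_one_div_ninety
  norm_num at *
  linarith

end Numerics

/-! ### Existence of refresh chains -/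

section Existence

variable {σ : Type*}

/-- The chain driven by a sequence of instructions: `some y` is the instruction to move to `y`, and
`none` is the instruction to stay. -/
def drivenChain (x₀ : σ) : ℕ → (ℕ → Option σ) → σ
  | 0, ω => (ω 0).getD x₀
  | n + 1, ω => (ω (n + 1)).getD (drivenChain x₀ n ω)

/-- Prescribing the beginning of the path constrains each instruction separately, so the event is a
box in the product space. -/
theorem drivenChain_eq_iff (x₀ : σ) (a : ℕ → σ) (n : ℕ) (ω : ℕ → Option σ) :
    (∀ i ≤ n, drivenChain x₀ i ω = a i) ↔
      ∀ i ≤ n, (ω i).getD (Nat.casesOn i x₀ a) = a i := by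
  induction n with
  | zero => simp [drivenChain]
  | succ n ih =>
    have split : ∀ p : ℕ → Prop, (∀ i ≤ n + 1, p i) ↔ (∀ i ≤ n, p i) ∧ p (n + 1) := fun p =>
      ⟨fun H => ⟨fun i hi => H i (by omega), H _ le_rfl⟩, fun H i hi => by
        rcases Nat.le_succ_iff.1 hi with hi | rfl
        exacts [H.1 i hi, H.2]⟩
    rw [split, split, ih]
    refine and_congr_right fun H => ?_
    rw [drivenChain, (ih.2 H) n le_rfl]

theorem exists_isMarkovChain_refreshMatrix {σ : Type} [Fintype σ] [DecidableEq σ] [Nonempty σ]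
    {c : ℝ} (hc : 0 ≤ c) (hc1 : c ≤ 1) {v : σ → ℝ} (hv : ∀ x, 0 ≤ v x) (h1 : ∑ x, v x = 1) :
    ∃ (Ω : Type) (_ : MeasurableSpace Ω) (μ : Measure Ω) (X : ℕ → Ω → σ),
      IsProbabilityMeasure μ ∧ IsMarkovChain μ X (refreshMatrix c v) := by
  let _ : MeasurableSpace (Option σ) := ⊤
  have _ : DiscreteMeasurableSpace (Option σ) := ⟨fun _ => trivial⟩
  let w : Option σ → ℝ := fun o => o.elim (1 - c) fun y => c * v y
  have hw : ∀ o, 0 ≤ w o := by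
    rintro (_ | y)
    · exact sub_nonneg.2 hc1
    · exact mul_nonneg hc (hv y)
  let ν : PMF (Option σ) := PMF.ofFintype (fun o => ENNReal.ofReal (w o)) (by
    rw [← ENNReal.ofReal_sum_of_nonneg fun o _ => hw o, Fintype.sum_option]
    simp [w, ← Finset.mul_sum, h1])
  have hν : ∀ x y, ν.toMeasure.real {o | o.getD x = y} = refreshMatrix c v x y := by
    intro x y
    rw [measureReal_def, PMF.toMeasure_apply_fintype, ENNReal.toReal_sum, Fintype.sum_option]
    · simp [Set.indicator_apply, ν, PMF.ofFintype_apply, w, refreshMatrix_apply,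
        apply_ite ENNReal.toReal, ENNReal.toReal_ofReal, mul_nonneg hc (hv _), hc1]
      ring
    · intro o _
      simp only [Set.indicator_apply, ν, PMF.ofFintype_apply]
      split_ifs <;> simp
  let μ : Measure (ℕ → Option σ) := Measure.infinitePi fun _ => ν.toMeasure
  obtain ⟨x₀⟩ := ‹Nonempty σ›
  have hbox : ∀ (a : ℕ → σ) (n : ℕ), μ.real {ω | ∀ i ≤ n, drivenChain x₀ i ω = a i} =
      ∏ i ∈ Finset.range (n + 1), ν.toMeasure.real {o | o.getD (Nat.casesOn i x₀ a) = a i} := by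
    intro a n
    have e : {ω : ℕ → Option σ | ∀ i ≤ n, drivenChain x₀ i ω = a i} =
        Set.pi (Finset.range (n + 1)) fun i => {o | o.getD (Nat.casesOn i x₀ a) = a i} := by
      ext ω
      simp only [Set.mem_ofPred_eq, drivenChain_eq_iff, Set.mem_pi, Finset.coe_range,
        Set.mem_Iio, Nat.lt_succ_iff]
    rw [e, measureReal_def, Measure.infinitePi_pi _ fun i _ => MeasurableSet.of_discrete,
      ENNReal.toReal_prod]
    rfl
  refine ⟨ℕ → Option σ, inferInstance, μ, drivenChain x₀, inferInstance, ?_,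
    refreshMatrix_nonneg hc hc1 hv, sum_refreshMatrix h1, fun n a => ?_⟩
  · intro n
    induction n with
    | zero =>
      intro a
      have hm : MeasurableSet {o : Option σ | o.getD x₀ = a} := MeasurableSet.of_discrete
      exact measurable_pi_apply (X := fun _ : ℕ => Option σ) 0 hm
    | succ n ih =>
      intro a
      have e : drivenChain x₀ (n + 1) ⁻¹' {a} = ⋃ x, drivenChain x₀ n ⁻¹' {x} ∩
          (fun ω => ω (n + 1)) ⁻¹' {o : Option σ | o.getD x = a} := by
        ext ω
        simp [drivenChain]
      rw [e]
      refine MeasurableSet.iUnion fun x => (ih x).inter ?_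
      have hm : MeasurableSet {o : Option σ | o.getD x = a} := MeasurableSet.of_discrete
      exact measurable_pi_apply (X := fun _ : ℕ => Option σ) (n + 1) hm
  · rw [hbox, hbox, Finset.prod_range_succ, hν]

end Existence

/-! ### Comparison of the regions -/

section Comparison

theorem lumpedRate_of_const {σ τ : Type*} [Fintype σ] [Finite τ] {c : ℝ} (hc : 0 ≤ c) (hc1 : c ≤ 1)
    {u : σ → ℝ} (hu : ∀ x, 0 ≤ u x) (h1 : ∑ x, u x = 1) {e : σ → τ} (he : ∀ x y, e x = e y) :
    lumpedRate c u e = 0 := by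
  have h0 : lumpedRate c u (fun _ => ()) = 0 := by
    rw [lumpedRate_eq, refreshRate]
    simp [pushDist, h1]
  rw [← h0]
  exact le_antisymm (lumpedRate_mono hc hc1 hu h1 _ _ fun x y _ => he x y)
    (lumpedRate_mono hc hc1 hu h1 _ _ fun _ _ _ => rfl)

theorem sumCoset_eq_iff {ι : Type*} [Fintype ι] {𝒳 : ι → Type*} {R : Type*} [Ring R]
    (k : ∀ t, 𝒳 t → R) (I : Ideal R) (z z' : SumState k) :
    sumCoset k I z = sumCoset k I z' ↔ -(z : R) + z' ∈ I :=
  QuotientAddGroup.eq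

theorem sumState_eq_iff {ι : Type*} [Fintype ι] {𝒳 : ι → Type*} {R : Type*} [Ring R]
    (k : ∀ t, 𝒳 t → R) (x y : ∀ t, 𝒳 t) :
    sumState k x = sumState k y ↔ ∑ t, k t (x t) = ∑ t, k t (y t) :=
  Subtype.ext_iff

theorem card_top_ideal (R : Type*) [Ring R] [Fintype R] :
    Nat.card (⊤ : Ideal R) = Fintype.card R := by
  rw [← Nat.card_eq_fintype_card]
  exact Nat.card_congr (Submodule.topEquiv (R := R) (M := R)).toEquiv

theorem log_card_pos (R : Type*) [Fintype R] [Nontrivial R] : 0 < Real.log (Fintype.card R) :=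
  Real.log_pos (by exact_mod_cast Fintype.one_lt_card)

/-- A sum of field elements that determines `exampleFun` has more than `9 / 20` bits of entropy
rate. If it takes one value on the two likely states, then it cannot take one value on the
fibre `{(1, 0, 0), (0, 1, 1)}` too, since the characteristic would have to be `2`, which is
incompatible with `exampleFun (1, 1, 1) ≠ exampleFun (0, 0, 0)`. -/
theorem lt_lumpedRate_of_field {𝔽 : Type*} [Field 𝔽] [Fintype 𝔽] {k : Fin 3 → Fin 2 → 𝔽}
    {h : 𝔽 → ZMod 4} (hk : IsPresentation exampleFun k h) :
    9 / 20 < lumpedRate (87 / 100) exampleDist (sumState k) := by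
  have hu : ∀ x, 0 ≤ exampleDist x := fun x => (exampleDist_pos x).le
  have hfac : ∀ x y, sumState k x = sumState k y → exampleFun x = exampleFun y := by
    intro x y hxy
    rw [sumState_eq_iff] at hxy
    rw [hk x, hk y, hxy]
  have h3 : ∀ x, exampleFun x = exampleFun ![0, 0, 1] → x = ![0, 0, 1] ∨ x = ![1, 1, 0] := by
    unfold exampleFun
    decide
  have h1 : ∀ x, exampleFun x = exampleFun ![0, 1, 1] → x = ![0, 1, 1] ∨ x = ![1, 0, 0] := by
    unfold exampleFun
    decide
  by_cases hA : sumState k ![1, 1, 0] = sumState k ![0, 0, 1]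
  · have hB : sumState k ![1, 0, 0] ≠ sumState k ![0, 1, 1] := by
      intro hB
      rw [sumState_eq_iff, Fin.sum_univ_three, Fin.sum_univ_three] at hA hB
      simp only [Matrix.cons_val] at hA hB
      have hne : ∀ x y, exampleFun x ≠ exampleFun y →
          k 0 (x 0) + k 1 (x 1) + k 2 (x 2) ≠ k 0 (y 0) + k 1 (y 1) + k 2 (y 2) := by
        intro x y hxy heq
        rw [← Fin.sum_univ_three fun t => k t (x t), ← Fin.sum_univ_three fun t => k t (y t)]
          at heq
        exact hxy (hfac x y ((sumState_eq_iff k x y).2 heq))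
      have d1 := hne ![0, 1, 0] ![0, 0, 0] (by unfold exampleFun; decide)
      have d2 := hne ![1, 1, 1] ![0, 0, 0] (by unfold exampleFun; decide)
      simp only [Matrix.cons_val] at d1 d2
      have e1 : (2 : 𝔽) * (k 1 1 - k 1 0) = 0 := by linear_combination hA - hB
      have e2 : (2 : 𝔽) = 0 := (mul_eq_zero.1 e1).resolve_right fun H => d1 (by
        linear_combination H)
      refine d2 ?_
      linear_combination (-1 : 𝔽) * hA + (k 0 1 - k 0 0 + k 1 1 - k 1 0) * e2
    have := lt_refreshRate_split
    rw [← lumpedRate_eq] at this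
    refine this.trans_le (lumpedRate_mono (by norm_num) (by norm_num) hu sum_exampleDist _ _ ?_)
    intro x y hxy
    have hg := hfac x y hxy
    refine Prod.ext hg ?_
    simp only [decide_eq_decide]
    constructor
    · rintro rfl
      exact (h1 y hg.symm).resolve_right fun hy => hB (by rw [hxy, hy])
    · rintro rfl
      exact (h1 x hg).resolve_right fun hx => hB (by rw [← hxy, hx])
  · have := lt_refreshRate_separate
    rw [← lumpedRate_eq] at this
    refine this.trans_le (lumpedRate_mono (by norm_num) (by norm_num) hu sum_exampleDist _ _ ?_)
    intro x y hxy
    have hg := hfac x y hxy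
    simp only [decide_eq_decide]
    constructor
    · rintro rfl
      exact (h3 y hg.symm).resolve_right fun hy => hA (by rw [hxy, hy])
    · rintro rfl
      exact (h3 x hg).resolve_right fun hx => hA (by rw [← hxy, hx])

theorem nontrivial_zmod_four : Nontrivial (ZMod 4) := ⟨0, 1, by decide⟩

theorem isPresentation_exampleCoeff : IsPresentation exampleFun exampleCoeff id := by
  unfold IsPresentation exampleFun exampleCoeff
  decide

/-- A non-zero ideal of `ZMod 4` is the whole ring, or consists of the even elements. -/
theorem ideal_zmod_four {I : Ideal (ZMod 4)} (hI : I ≠ ⊥) :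
    I = ⊤ ∨ ∀ z, z ∈ I ↔ parity z = false := by
  by_cases h : ∃ z ∈ I, parity z = true
  · left
    obtain ⟨z, hz, hp⟩ := h
    refine Ideal.eq_top_of_isUnit_mem I hz (IsUnit.of_mul_eq_one z ?_)
    revert hp
    clear hz
    unfold parity
    decide +revert
  · right
    push Not at h
    have h2 : (2 : ZMod 4) ∈ I := by
      obtain ⟨z, hz, hz0⟩ := Submodule.exists_mem_ne_zero_of_ne_bot hI
      have hp := h z hz
      have : z = 2 := by
        clear h hz
        unfold parity at hp
        decide +revert
      rwa [← this]
    refine fun z => ⟨fun hz => by simpa using h z hz, fun hz => ?_⟩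
    have : z = 0 ∨ z = 2 := by
      unfold parity at hz
      decide +revert
    rcases this with rfl | rfl
    · exact I.zero_mem
    · exact h2

variable {Ω : Type*} [MeasurableSpace Ω] {μ : Measure Ω} [IsProbabilityMeasure μ]
  {X : ℕ → Ω → Fin 3 → Fin 2}

/-- The two thresholds come from the ideals `ZMod 4` and `2 ZMod 4`. -/
theorem mem_ringRegion_exampleCoeff_iff (hX : IsMarkovChain μ X exampleMatrix) (ρ : Fin 3 → ℝ) :
    ρ ∈ ringRegion μ X exampleCoeff ↔ ∃ r : ℝ, (ρ = fun _ => r) ∧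
      refreshRate (87 / 100) (pushDist exampleDist exampleFun) < r ∧
      2 * (refreshRate (87 / 100) (pushDist exampleDist exampleFun) -
        refreshRate (87 / 100) (pushDist (pushDist exampleDist exampleFun) parity)) < r := by
  rw [exampleMatrix_eq] at hX
  have hu : ∀ x, 0 ≤ exampleDist x := fun x => (exampleDist_pos x).le
  have hsum : ∀ x, ((sumState exampleCoeff x : SumState exampleCoeff) : ZMod 4) = exampleFun x :=
    fun x => (isPresentation_exampleCoeff x).symm
  have e1 : lumpedRate (87 / 100) exampleDist (sumState exampleCoeff) =
      refreshRate (87 / 100) (pushDist exampleDist exampleFun) := by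
    rw [← lumpedRate_eq]
    refine le_antisymm (lumpedRate_mono (by norm_num) (by norm_num) hu sum_exampleDist _ _ ?_)
      (lumpedRate_mono (by norm_num) (by norm_num) hu sum_exampleDist _ _ ?_)
    · intro x y hxy
      rwa [Subtype.ext_iff, hsum, hsum]
    · intro x y hxy
      rw [← hsum, hxy, hsum]
  have etop : lumpedRate (87 / 100) exampleDist
      (fun x => sumCoset exampleCoeff ⊤ (sumState exampleCoeff x)) = 0 :=
    lumpedRate_of_const (by norm_num) (by norm_num) hu sum_exampleDist fun x y => by
      rw [sumCoset_eq_iff]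
      trivial
  have eeven : ∀ I : Ideal (ZMod 4), (∀ z, z ∈ I ↔ parity z = false) →
      lumpedRate (87 / 100) exampleDist
        (fun x => sumCoset exampleCoeff I (sumState exampleCoeff x)) =
      refreshRate (87 / 100) (pushDist (pushDist exampleDist exampleFun) parity) := by
    intro I hI
    have hpar : ∀ x y, sumCoset exampleCoeff I (sumState exampleCoeff x) =
        sumCoset exampleCoeff I (sumState exampleCoeff y) ↔
        (parity ∘ exampleFun) x = (parity ∘ exampleFun) y := by
      intro x y
      rw [sumCoset_eq_iff, hI, hsum, hsum]
      have : ∀ a b : ZMod 4, parity (-a + b) = false ↔ parity a = parity b := by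
        unfold parity
        decide
      exact this _ _
    rw [← pushDist_comp, ← lumpedRate_eq]
    exact le_antisymm
      (lumpedRate_mono (by norm_num) (by norm_num) hu sum_exampleDist _ _ fun x y => (hpar x y).2)
      (lumpedRate_mono (by norm_num) (by norm_num) hu sum_exampleDist _ _ fun x y => (hpar x y).1)
  have := nontrivial_zmod_four
  have hlog4 := (log_card_pos (ZMod 4)).ne'
  have htop : Real.log (Fintype.card (ZMod 4)) / Real.log (Nat.card (⊤ : Ideal (ZMod 4))) = 1 := by
    rw [card_top_ideal, div_self hlog4]
  have heven : ∀ I : Ideal (ZMod 4), (∀ z, z ∈ I ↔ parity z = false) →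
      Real.log (Fintype.card (ZMod 4)) / Real.log (Nat.card I) = 2 := by
    intro I hI
    have hcard : Nat.card I = 2 := by
      rw [Nat.card_congr (Equiv.subtypeEquivRight hI), Nat.card_eq_fintype_card]
      unfold parity
      decide
    have h2 : Real.log 2 ≠ 0 := (Real.log_pos (by norm_num)).ne'
    rw [hcard, ZMod.card, div_eq_iff (by exact_mod_cast h2)]
    have : ((4 : ℕ) : ℝ) = 2 ^ 2 := by norm_num
    rw [this, Real.log_pow]
    norm_num
  rw [mem_ringRegion_iff hX (by norm_num) (by norm_num) exampleDist_pos sum_exampleDist]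
  refine exists_congr fun r => and_congr_right fun _ => ⟨fun H => ⟨?_, ?_⟩, ?_⟩
  · have := H ⊤ top_ne_bot
    rwa [htop, e1, etop, one_mul, sub_zero] at this
  · set J : Ideal (ZMod 4) := Ideal.span {2} with hJ
    have hJ0 : J ≠ ⊥ := by
      rw [hJ, Ne, Ideal.span_singleton_eq_bot]
      decide
    have hJtop : J ≠ ⊤ := by
      rw [hJ, Ne, Ideal.span_singleton_eq_top]
      decide
    have hJ' := (ideal_zmod_four hJ0).resolve_left hJtop
    have := H J hJ0
    rwa [heven J hJ', e1, eeven J hJ'] at this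
  · rintro ⟨h1, h2⟩ I hI
    rcases ideal_zmod_four hI with rfl | hI'
    · rwa [htop, e1, etop, one_mul, sub_zero]
    · rwa [heven I hI', e1, eeven I hI']

theorem const_mem_ringRegion_exampleCoeff (hX : IsMarkovChain μ X exampleMatrix) {r : ℝ}
    (hr : 9 / 20 ≤ r) : (fun _ => r) ∈ ringRegion μ X exampleCoeff :=
  (mem_ringRegion_exampleCoeff_iff hX _).2
    ⟨r, rfl, refreshRate_exampleFun_lt.trans_le hr, refreshRate_parity_lt.trans_le hr⟩

theorem lt_of_mem_ringRegion_field (hX : IsMarkovChain μ X exampleMatrix) {𝔽 : Type*} [Field 𝔽]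
    [Fintype 𝔽] {k : Fin 3 → Fin 2 → 𝔽} {h : 𝔽 → ZMod 4} (hk : IsPresentation exampleFun k h)
    {ρ : Fin 3 → ℝ} (hρ : ρ ∈ ringRegion μ X k) : ∃ r : ℝ, (ρ = fun _ => r) ∧ 9 / 20 < r := by
  rw [exampleMatrix_eq] at hX
  have hu : ∀ x, 0 ≤ exampleDist x := fun x => (exampleDist_pos x).le
  rw [mem_ringRegion_iff hX (by norm_num) (by norm_num) exampleDist_pos sum_exampleDist] at hρ
  obtain ⟨r, hr, H⟩ := hρ
  have := H ⊤ top_ne_bot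
  rw [card_top_ideal, div_self (log_card_pos 𝔽).ne', one_mul,
    lumpedRate_of_const (by norm_num) (by norm_num) hu sum_exampleDist
      (e := fun x => sumCoset k ⊤ (sumState k x)) fun x y => by
        rw [sumCoset_eq_iff]
        trivial,
    sub_zero] at this
  exact ⟨r, hr, (lt_lumpedRate_of_field hk).trans this⟩

theorem const_notMem_sourceRegion (hX : IsMarkovChain μ X exampleMatrix) :
    (fun _ => 9 / 20 : Fin 3 → ℝ) ∉ sourceRegion μ X := by
  intro h
  rw [exampleMatrix_eq] at hX
  obtain ⟨l, hl, hlt⟩ := h Finset.univ Finset.univ_nonempty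
  have hl' := hX.tendsto_entropy_history (by norm_num) (by norm_num) sum_exampleDist
  have : ∀ n : ℕ, entropy μ (fun ω (i : Fin n) (t : {t : Fin 3 // t ∉ Finset.univ}) => X i ω t) =
      0 := fun n => by
    have : IsEmpty {t : Fin 3 // t ∉ Finset.univ} := ⟨fun t => t.2 (Finset.mem_univ _)⟩
    exact entropy_of_subsingleton _
  simp only [this, sub_zero] at hl
  have hll := tendsto_nhds_unique hl hl'
  have := lt_refreshRate_exampleDist
  rw [Fin.sum_univ_three] at hlt
  linarith

end Comparison

end MarkovCoding

end

theorem mainTheorem6 :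
    IsPresentation exampleFun exampleCoeff id ∧
    (∃ (Ω : Type) (_ : MeasurableSpace Ω) (μ : Measure Ω) (X : ℕ → Ω → Fin 3 → Fin 2),
      IsProbabilityMeasure μ ∧ IsMarkovChain μ X exampleMatrix) ∧
    ∀ (Ω : Type*) [MeasurableSpace Ω] (μ : Measure Ω) [IsProbabilityMeasure μ]
      (X : ℕ → Ω → Fin 3 → Fin 2), IsMarkovChain μ X exampleMatrix →
      (∀ (𝔽 : Type) [Field 𝔽] [Fintype 𝔽] (k : Fin 3 → Fin 2 → 𝔽) (h : 𝔽 → ZMod 4),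
        IsPresentation exampleFun k h → ringRegion μ X k ⊂ ringRegion μ X exampleCoeff) ∧
      fieldCodingRegion μ X exampleFun ⊂ ringCodingRegion μ X exampleFun ∧
      ¬ ringRegion μ X exampleCoeff ⊆ fieldCodingRegion μ X exampleFun ∧
      ringRegion μ X exampleCoeff ⊆ linearlyAchievableRegion μ X exampleFun exampleCoeff ∧
      ringRegion μ X exampleCoeff ⊆ achievableRegion μ X exampleFun := by
  refine ⟨isPresentation_exampleCoeff, ?_, ?_⟩
  · rw [exampleMatrix_eq]
    exact exists_isMarkovChain_refreshMatrix (by norm_num) (by norm_num)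
      (fun x => (exampleDist_pos x).le) sum_exampleDist
  intro Ω _ μ _ X hX
  have hmem := const_mem_ringRegion_exampleCoeff hX le_rfl
  have hnot : ∀ (𝔽 : Type) [Field 𝔽] [Fintype 𝔽] (k : Fin 3 → Fin 2 → 𝔽) (h : 𝔽 → ZMod 4),
      IsPresentation exampleFun k h → (fun _ => 9 / 20) ∉ ringRegion μ X k := by
    intro 𝔽 _ _ k h hk H
    obtain ⟨r, hr, hlt⟩ := lt_of_mem_ringRegion_field hX hk H
    exact hlt.ne (congrFun hr 0)
  have hnotField : (fun _ => 9 / 20) ∉ fieldCodingRegion μ X exampleFun := by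
    rintro (H | ⟨𝔽, _, _, k, h, hk, H⟩)
    · exact const_notMem_sourceRegion hX H
    · exact hnot 𝔽 k h hk H
  have hlin : ringRegion μ X exampleCoeff ⊆
      linearlyAchievableRegion μ X exampleFun exampleCoeff := by
    intro ρ hρ
    obtain ⟨r, rfl, h1, h2⟩ := (mem_ringRegion_exampleCoeff_iff hX ρ).1 hρ
    have hu : ∀ x, 0 ≤ exampleDist x := fun x => (exampleDist_pos x).le
    refine mem_linearlyAchievableRegion isPresentation_exampleCoeff
      ((exampleMatrix_eq ▸ hX).lump_refreshMatrix (by norm_num) (by norm_num) hu sum_exampleDist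
        exampleFun) (by norm_num) (by norm_num) (fun z => ?_)
      (by rw [sum_pushDist, sum_exampleDist]) h1 h2
    rw [pushDist_exampleFun]
    beta_reduce
    split_ifs <;> norm_num
  refine ⟨fun 𝔽 _ _ k h hk => ⟨fun ρ hρ => ?_, fun H => hnot 𝔽 k h hk (H hmem)⟩,
    ⟨?_, fun H => hnotField (H (Or.inr ?_))⟩, fun H => hnotField (H hmem), hlin,
    hlin.trans (linearlyAchievableRegion_subset_achievableRegion μ X _ _)⟩
  · obtain ⟨r, rfl, hr⟩ := lt_of_mem_ringRegion_field hX hk hρ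
    exact const_mem_ringRegion_exampleCoeff hX hr.le
  · rintro ρ (H | ⟨𝔽, _, _, k, h, hk, H⟩)
    · exact Or.inl H
    · exact Or.inr ⟨𝔽, _, inferInstance, _, k, h, hk, H⟩
  · exact ⟨ZMod 4, _, nontrivial_zmod_four, _, exampleCoeff, id, isPresentation_exampleCoeff, hmem⟩
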